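/- For integers $m_1,m_2\ge 1$, a group of type $\mathcal D_3$ is a group with presentation $$G=\langle x,y,t_1,t_2 \mid x^2=t_1^{2^{m_1}}=t_2^{2^{m_2}}=1,\ y^2=t_2,\ t_1,t_2 \text{ central},\ (x,y)=t_1^{2^{m_1-1}}\rangle,$$ where $(x,y)$ is the commutator of $x$ and $y$. A quaternion algebra over a field $E$ of characteristic different from $2$ is an $E$-algebra with basis $1,i,j,ij$ such that $i^2=a$, $j^2=b$, $ij=-ji$ for some nonzero $a,b\in E$ (so $M_2(E)$ is allowed). When a $K$-algebra is said to be a direct sum of fields and quaternion algebras, the fields, and the fields over which the quaternion algebras are defined, are extensions of $K$, and the decomposition is one of $K$-algebras. Theorem. Let $G$ be a group of type $\mathcal D_3$ with $m_1\ge3$ and $m_2\ge3$. Set $$N=\begin{cases}2^{m_2}(5+4m_1-4m_2)-4 & \text{if } m_1-1\ge m_2+1,\\ 9\cdot 2^{m_2}-4 & \text{if } m_2=m_1-1,\\ 2^{m_1-1}(12+3m_2-3m_1)-4 & \text{if } m_1\le m_2,\end{cases}$$ $$N_0=\begin{cases}2^{m_2+2}(1+m_1-m_2)-4 & \text{if }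 m_1-1\ge m_2+1,\\ 8\cdot 2^{m_2}-4 & \text{if } m_2=m_1-1,\\ 2^{m_1}(5+m_2-m_1)-4 & \text{if } m_1\le m_2,\end{cases}$$ $M=2N-20$ and $M_0=2N_0-20$. Then $\mathbb{Q}G$ is the direct sum of $N_0$ fields and $N-N_0$ quaternion algebras. For any finite field $K$ of odd order $q$, $KG$ is the direct sum of at least $M_0$ fields and at least $M-M_0$ quaternion algebras, and of exactly $M_0$ fields and exactly $M-M_0$ quaternion algebras if $q\equiv3\pmod 8$. -/

import Mathlib

universe u v

/-- The generators of a group of type `D₃`. -/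
inductive D3Gen : Type
  | x
  | y
  | t₁
  | t₂

open scoped commutatorElement in
/-- The relators `x² = t₁^(2^m₁) = t₂^(2^m₂) = 1`, `y² = t₂`, `t₁` and `t₂` central,
`(x, y) = t₁^(2^(m₁-1))`. -/
def D3Rels (m₁ m₂ : ℕ) : Set (FreeGroup D3Gen) :=
  let x := FreeGroup.of D3Gen.x
  let y := FreeGroup.of D3Gen.y
  let t₁ := FreeGroup.of D3Gen.t₁
  let t₂ := FreeGroup.of D3Gen.t₂
  {x ^ 2, t₁ ^ (2 ^ m₁), t₂ ^ (2 ^ m₂), y ^ 2 * t₂⁻¹,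
    ⁅t₁, x⁆, ⁅t₁, y⁆, ⁅t₁, t₂⁆, ⁅t₂, x⁆, ⁅t₂, y⁆,
    ⁅x, y⁆ * (t₁ ^ (2 ^ (m₁ - 1)))⁻¹}

/-- `G` is a group of type `D₃` with parameters `m₁, m₂ ≥ 1`: it is isomorphic to
`⟨x, y, t₁, t₂ ∣ x² = t₁^(2^m₁) = t₂^(2^m₂) = 1, y² = t₂, t₁ and t₂ central,
(x, y) = t₁^(2^(m₁-1))⟩`. -/
def IsTypeD3 (m₁ m₂ : ℕ) (G : Type v) [Group G] : Prop :=
  1 ≤ m₁ ∧ 1 ≤ m₂ ∧ Nonempty (G ≃* PresentedGroup (D3Rels m₁ m₂))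

/-- The `K`-algebra `A`, where `K` is a field of characteristic not `2`, is a (generalized)
quaternion algebra over some extension field `E` of `K`: it has an `E`-basis `1, i, j, ij` with
`i² = a`, `j² = b`, `ij = -ji` for some nonzero `a b : E`. The algebra of `2 × 2` matrices over `E`
is one of these. -/
def IsQuaternionComponent (K : Type u) [Field K] (A : Type u) [Ring A] [Algebra K A] : Prop :=
  ∃ (E : Type u) (_ : Field E) (_ : Algebra K E) (a b : E),
    a ≠ 0 ∧ b ≠ 0 ∧ Nonempty (A ≃ₐ[K] QuaternionAlgebra E a 0 b)

/-- As a `K`-algebra, `A` is the direct sum of `r` fields and `k` quaternion algebras. -/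
def IsSumOfFieldsAndQuaternions (K : Type u) [Field K] (A : Type*) [Ring A] [Algebra K A]
    (r k : ℕ) : Prop :=
  ∃ (F : Fin r → Type u) (_ : ∀ i, Ring (F i)) (_ : ∀ i, Algebra K (F i))
    (Q : Fin k → Type u) (_ : ∀ j, Ring (Q j)) (_ : ∀ j, Algebra K (Q j)),
    (∀ i, IsField (F i)) ∧ (∀ j, IsQuaternionComponent K (Q j)) ∧
      Nonempty (A ≃ₐ[K] (∀ i, F i) × (∀ j, Q j))

/-- The number `N` attached to `m₁, m₂`; the three cases are `m₁ - 1 ≥ m₂ + 1`, `m₂ = m₁ - 1`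
and `m₁ ≤ m₂`. -/
def numN (m₁ m₂ : ℕ) : ℤ :=
  if m₂ + 2 ≤ m₁ then 2 ^ m₂ * (5 + 4 * (m₁ : ℤ) - 4 * (m₂ : ℤ)) - 4
  else if m₁ = m₂ + 1 then 9 * 2 ^ m₂ - 4
  else 2 ^ (m₁ - 1) * (12 + 3 * (m₂ : ℤ) - 3 * (m₁ : ℤ)) - 4

/-- The number `N₀` attached to `m₁, m₂`, with the same three cases. -/
def numN₀ (m₁ m₂ : ℕ) : ℤ :=
  if m₂ + 2 ≤ m₁ then 2 ^ (m₂ + 2) * (1 + (m₁ : ℤ) - (m₂ : ℤ)) - 4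
  else if m₁ = m₂ + 1 then 8 * 2 ^ m₂ - 4
  else 2 ^ m₁ * (5 + (m₂ : ℤ) - (m₁ : ℤ)) - 4

/-! Let z = t₁^(2^(m₁-1)) be the commutator of x and y, a central element with z² = 1. As 2 is
invertible, (1 ± z)/2 split the group algebra in two. Where z = 1 it becomes the algebra of the
abelian group C₂ × C_{2^(m₁-1)} × C_{2^(m₂+1)} generated by x, t₁, y, a product of fields. Where z =
-1 the elements t₁, t₂ generate a commutative algebra S, over which x² = 1, y² = t₂, xy = -yx define
the quaternion algebra (1, t₂); there is one quaternion component for each residue field of S.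

Both commutative algebras have the form `RootAlgebra`. The group algebra maps onto the product of
their residue fields, resp. of quaternion algebras over them. A normal form bounds |G| by
2^(m₁+m₂+2), which is the dimension of the target, so the map is an isomorphism
(`isSumOfFieldsAndQuaternions_of_surjective`).

It remains to count maximal ideals. Each residue field is K(ζ) with ζ a primitive 2^k-th root of
unity, k being its level, and has some degree d(k). Maximal ideals of level k, times d(k), number
the solutions of level k in the algebraic closure (`card_level_mul`), and this number is the same
for all K of characteristic not 2. Over ℚ, d(k) = φ(2^k). Over 𝔽_q, d(k) is the order of q modulo
2^k: at most φ(2^k), at most φ(2^k)/2 for k ≥ 3, with equality in the applicable bound if q ≡ 3 mod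
8. So every level k ≥ 3 at least doubles its components. Levels 0, 1, 2 hold 1 + 7 + 12 = 20 fields
and no quaternion algebra, whence the -20. -/

open Module

/-! ### Levels of families of roots of unity -/

/-- The least `k` such that every `v i` is a `2 ^ k`-th root of unity. -/
noncomputable def torsionLevel {ι M : Type*} [Monoid M] (v : ι → M) : ℕ :=
  sInf {k | ∀ i, v i ^ 2 ^ k = 1}

/-- The hypothesis keeps the set of exponents nonempty; otherwise its infimum would be the default
0. -/
theorem torsionLevel_le_iff {ι M : Type*} [Monoid M] {v : ι → M} {n : ℕ}
    (h : ∀ i, v i ^ 2 ^ n = 1) (k : ℕ) : torsionLevel v ≤ k ↔ ∀ i, v i ^ 2 ^ k = 1 := by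
  have hmem : torsionLevel v ∈ {k | ∀ i, v i ^ 2 ^ k = 1} := Nat.sInf_mem ⟨n, h⟩
  refine ⟨fun hk i => ?_, fun hk => Nat.sInf_le hk⟩
  obtain ⟨j, rfl⟩ := Nat.exists_eq_add_of_le hk
  rw [pow_add, pow_mul, hmem i, one_pow]

theorem torsionLevel_comp {ι M N : Type*} [Monoid M] [Monoid N] (f : M →* N)
    (hf : Function.Injective f) (v : ι → M) : torsionLevel (fun i => f (v i)) = torsionLevel v := by
  simp only [torsionLevel, ← map_pow, map_eq_one_iff f hf]

/-- Some `v i` attains the level, so its order is exactly 2^level, and in a field all the other `v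
j` are powers of it. -/
theorem exists_isPrimitiveRoot_adjoin_eq_top {K E ι : Type*} [Field K] [Field E] [Algebra K E]
    {v : ι → E} {n : ℕ} (h : ∀ i, v i ^ 2 ^ n = 1) (hv : Algebra.adjoin K (Set.range v) = ⊤) :
    ∃ ζ : E, IsPrimitiveRoot ζ (2 ^ torsionLevel v) ∧ Algebra.adjoin K {ζ} = ⊤ := by
  have hk := (torsionLevel_le_iff h _).1 le_rfl
  have key : ∃ ζ : E, IsPrimitiveRoot ζ (2 ^ torsionLevel v) := by
    rcases Nat.eq_zero_or_pos (torsionLevel v) with h0 | h0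
    · rw [h0]
      exact ⟨1, by simp⟩
    · obtain ⟨k, hk'⟩ := Nat.exists_eq_succ_of_ne_zero h0.ne'
      have : ¬ torsionLevel v ≤ k := by omega
      rw [torsionLevel_le_iff h, not_forall] at this
      obtain ⟨i, hi⟩ := this
      rw [hk'] at hk ⊢
      exact ⟨v i, IsPrimitiveRoot.iff_orderOf.2 (orderOf_eq_prime_pow hi (hk i))⟩
  obtain ⟨ζ, hζ⟩ := key
  refine ⟨ζ, hζ, ?_⟩
  rw [eq_top_iff, ← hv, Algebra.adjoin_le_iff]
  rintro _ ⟨i, rfl⟩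
  obtain ⟨j, -, hj⟩ := hζ.eq_pow_of_pow_eq_one (hk i)
  rw [← hj]
  exact pow_mem (Algebra.self_mem_adjoin_singleton K ζ) j

/-! ### Maximal ideals and points over the algebraic closure -/

/-- The kernel of a homomorphism from a finite-dimensional algebra to a field extension. -/
def kerMaximal {K R L : Type*} [Field K] [CommRing R] [Algebra K R] [Module.Finite K R]
    [Field L] [Algebra K L] (φ : R →ₐ[K] L) : MaximalSpectrum R where
  asIdeal := RingHom.ker φ
  isMaximal := by
    have : IsArtinianRing R := IsArtinianRing.of_finite K R
    have : (RingHom.ker φ).IsPrime := RingHom.ker_isPrime φ.toRingHom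
    exact Ideal.isMaximal_of_isPrime _

/-- Homomorphisms with kernel `m` are homomorphisms from `R ⧸ m`. -/
noncomputable def kerMaximalFiberEquiv {K R L : Type*} [Field K] [CommRing R] [Algebra K R]
    [Module.Finite K R] [Field L] [Algebra K L] (m : MaximalSpectrum R) :
    {φ : R →ₐ[K] L // kerMaximal φ = m} ≃ (R ⧸ m.asIdeal →ₐ[K] L) where
  toFun φ := Ideal.Quotient.liftₐ m.asIdeal φ.1 fun a ha => by
    have h : a ∈ (kerMaximal φ.1).asIdeal := by rwa [φ.2]
    exact h
  invFun ψ := ⟨ψ.comp (Ideal.Quotient.mkₐ K m.asIdeal), by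
    let _ := Ideal.Quotient.field m.asIdeal
    ext a
    change ψ (Ideal.Quotient.mk m.asIdeal a) = 0 ↔ _
    rw [← Ideal.Quotient.eq_zero_iff_mem]
    exact map_eq_zero_iff ψ ψ.toRingHom.injective⟩
  left_inv φ := by
    ext a
    rfl
  right_inv ψ := by
    apply Ideal.Quotient.algHom_ext
    ext a
    rfl

/-- Homomorphisms to the closure are sorted by their kernels, and a separable residue field has as
many embeddings as its degree. `R` need not be reduced. -/
theorem sum_finrank_quotient_maximal {K R : Type*} [Field K] [PerfectField K] [CommRing R]
    [Algebra K R] [Module.Finite K R] [Fintype (MaximalSpectrum R)]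
    (p : MaximalSpectrum R → Prop) [DecidablePred p] :
    ∑ m with p m, finrank K (R ⧸ m.asIdeal) =
      Nat.card {φ : R →ₐ[K] AlgebraicClosure K // p (kerMaximal φ)} := by
  have h1 : ∀ m : MaximalSpectrum R, finrank K (R ⧸ m.asIdeal) =
      Nat.card {φ : R →ₐ[K] AlgebraicClosure K // kerMaximal φ = m} := fun m => by
    let _ := Ideal.Quotient.field m.asIdeal
    rw [Nat.card_congr (kerMaximalFiberEquiv m), Nat.card_eq_fintype_card]
    exact (AlgHom.card K (R ⧸ m.asIdeal) (AlgebraicClosure K)).symm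
  have h2 := Nat.card_congr (Equiv.sigmaSubtypeFiberEquivSubtype
    (kerMaximal : (R →ₐ[K] AlgebraicClosure K) → _) (p := fun φ => p (kerMaximal φ)) (q := p)
    (fun _ => Iff.rfl))
  rw [← h2, Nat.card_sigma]
  rw [← Finset.sum_subtype_eq_sum_filter, Finset.subtype_univ]
  exact Finset.sum_congr rfl fun m _ => h1 m

/-! ### Algebras defined by equations X^e = c -/

/-- The algebra with generators `X i` and relations `X i ^ e i = c i`. -/
abbrev RootAlgebra {ι : Type*} (K : Type*) [Field K] (e : ι → ℕ) (c : ι → K) : Type _ :=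
  MvPolynomial ι K ⧸ Ideal.span (Set.range fun i =>
    (MvPolynomial.X i ^ e i - MvPolynomial.C (c i) : MvPolynomial ι K))

namespace RootAlgebra

variable {ι K : Type*} [Field K] {e : ι → ℕ} {c : ι → K}

/-- The generators. -/
noncomputable def gen (e : ι → ℕ) (c : ι → K) (i : ι) : RootAlgebra K e c :=
  Ideal.Quotient.mk _ (MvPolynomial.X i)

theorem gen_pow (i : ι) : gen e c i ^ e i = algebraMap K _ (c i) := by
  rw [← sub_eq_zero]
  exact Ideal.Quotient.eq_zero_iff_mem.2 (Ideal.subset_span ⟨i, rfl⟩)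

theorem adjoin_gen : Algebra.adjoin K (Set.range (gen e c)) = ⊤ := by
  have h := congrArg (Subalgebra.map (Ideal.Quotient.mkₐ K (Ideal.span (Set.range fun i =>
    (MvPolynomial.X i ^ e i - MvPolynomial.C (c i) : MvPolynomial ι K)))))
    (MvPolynomial.adjoin_range_X (R := K) (σ := ι))
  rw [AlgHom.map_adjoin, ← Set.range_comp, Algebra.map_top,
    (AlgHom.range_eq_top _).2 (Ideal.Quotient.mkₐ_surjective K _)] at h
  exact h

theorem finite [Finite ι] (he : ∀ i, e i ≠ 0) : Module.Finite K (RootAlgebra K e c) := by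
  refine ⟨?_⟩
  rw [← Algebra.top_toSubmodule, ← adjoin_gen]
  refine fg_adjoin_of_finite (Set.finite_range _) ?_
  rintro _ ⟨i, rfl⟩
  refine IsIntegral.of_pow (Nat.pos_of_ne_zero (he i)) ?_
  rw [gen_pow]
  exact isIntegral_algebraMap

/-- Homomorphisms are determined by the images of the generators. -/
noncomputable def algHomEquiv (L : Type*) [CommRing L] [Algebra K L] :
    (RootAlgebra K e c →ₐ[K] L) ≃ {v : ι → L // ∀ i, v i ^ e i = algebraMap K L (c i)} where
  toFun φ := ⟨fun i => φ (gen e c i), fun i => by rw [← map_pow, gen_pow, AlgHom.commutes]⟩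
  invFun v := Ideal.Quotient.liftₐ _ (MvPolynomial.aeval v.1) fun a ha => by
    change a ∈ RingHom.ker (MvPolynomial.aeval v.1)
    revert a
    change Ideal.span _ ≤ _
    rw [Ideal.span_le]
    rintro _ ⟨i, rfl⟩
    simp [RingHom.mem_ker, v.2 i]
  left_inv φ := by
    apply Ideal.Quotient.algHom_ext
    apply MvPolynomial.algHom_ext
    intro i
    exact MvPolynomial.aeval_X _ i
  right_inv v := by
    ext i
    exact MvPolynomial.aeval_X _ i

theorem algHomEquiv_apply {L : Type*} [CommRing L] [Algebra K L] (φ : RootAlgebra K e c →ₐ[K] L) :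
    (algHomEquiv L φ).1 = fun i => φ (gen e c i) := rfl

end RootAlgebra

/-! ### Counting 2-power roots of 1 and of -1 -/

theorem card_root_of_pow_eq_one {L : Type*} [Field L] [IsAlgClosed L] (h2 : (2 : L) ≠ 0) (a : ℕ) :
    Nat.card {x : L // x ^ 2 ^ a = 1} = 2 ^ a := by
  have : NeZero ((2 ^ a : ℕ) : L) := ⟨by simpa using pow_ne_zero a h2⟩
  obtain ⟨ζ, hζ⟩ := HasEnoughRootsOfUnity.exists_primitiveRoot L (2 ^ a)
  rw [Nat.subtype_card (Polynomial.nthRootsFinset (2 ^ a) (1 : L))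
    fun x => Polynomial.mem_nthRootsFinset (pow_pos two_pos a) 1, hζ.card_nthRootsFinset]

theorem card_root_of_pow_eq_one_and {L : Type*} [Field L] [IsAlgClosed L] (h2 : (2 : L) ≠ 0)
    (a k : ℕ) : Nat.card {x : L // x ^ 2 ^ a = 1 ∧ x ^ 2 ^ k = 1} = 2 ^ min a k := by
  rw [← card_root_of_pow_eq_one (L := L) h2 (min a k)]
  refine Nat.card_congr (Equiv.subtypeEquivRight fun x => ?_)
  rcases le_total a k with h | h <;> obtain ⟨j, rfl⟩ := Nat.exists_eq_add_of_le h
  · rw [min_eq_left h, and_iff_left_iff_imp]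
    intro hx
    rw [pow_add, pow_mul, hx, one_pow]
  · rw [min_eq_right h, and_iff_right_iff_imp]
    intro hx
    rw [pow_add, pow_mul, hx, one_pow]

/-- A root of -1 here has order exactly 2^(a+1), so the second equation holds for all of them or for
none. The roots form a coset ω·μ_{2^a}. -/
theorem card_root_of_pow_eq_neg_one_and {L : Type*} [Field L] [IsAlgClosed L] (h2 : (2 : L) ≠ 0)
    (a k : ℕ) : Nat.card {x : L // x ^ 2 ^ a = -1 ∧ x ^ 2 ^ k = 1} =
      if a < k then 2 ^ a else 0 := by
  have hne : (-1 : L) ≠ 1 := fun h => h2 (by linear_combination -h)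
  split_ifs with h
  · obtain ⟨ω, hω⟩ := IsAlgClosed.exists_pow_nat_eq (-1 : L) (pow_pos two_pos a)
    have hω0 : ω ≠ 0 := by
      rintro rfl
      rw [zero_pow (pow_pos two_pos a).ne'] at hω
      exact one_ne_zero (neg_eq_zero.1 hω.symm)
    refine Eq.trans (Nat.card_congr ((Equiv.mulLeft₀ ω hω0).subtypeEquiv fun x => ?_).symm)
      (card_root_of_pow_eq_one (L := L) h2 a)
    obtain ⟨j, rfl⟩ := Nat.exists_eq_add_of_lt h
    simp only [Equiv.mulLeft₀_apply, mul_pow, hω, pow_succ, pow_add]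
    constructor
    · intro hx
      simp [pow_mul, hx, hω, neg_one_pow_eq_or]
    · rintro ⟨hx, -⟩
      linear_combination -hx
  · rw [Nat.card_eq_zero]
    left
    refine ⟨fun ⟨x, hx, hx'⟩ => hne ?_⟩
    obtain ⟨j, rfl⟩ := Nat.exists_eq_add_of_le (not_lt.1 h)
    rw [← hx, pow_add, pow_mul, hx', one_pow]

/-! ### Maximal ideals counted by level -/

/-- The extensions of `K` by a primitive `2 ^ k`-th root of unity have degree `d k`. -/
def HasCyclotomicDegrees (K : Type u) [Field K] (d : ℕ → ℕ) : Prop :=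
  ∀ (E : Type u) [Field E] [Algebra K E] (ζ : E) (k : ℕ), IsPrimitiveRoot ζ (2 ^ k) →
    Algebra.adjoin K {ζ} = ⊤ → finrank K E = d k

namespace RootAlgebra

variable {ι : Type} {K : Type u} [Field K] {e : ι → ℕ} {c : ι → K}

/-- The level of the family of the images of the generators in a residue field. -/
noncomputable def level (m : MaximalSpectrum (RootAlgebra K e c)) : ℕ :=
  torsionLevel fun i => Ideal.Quotient.mk m.asIdeal (gen e c i)

theorem level_kerMaximal [Module.Finite K (RootAlgebra K e c)] {L : Type*} [Field L] [Algebra K L]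
    (φ : RootAlgebra K e c →ₐ[K] L) :
    level (kerMaximal φ) = torsionLevel fun i => φ (gen e c i) :=
  (torsionLevel_comp (RingHom.kerLift φ.toRingHom).toMonoidHom
    (RingHom.kerLift_injective φ.toRingHom) _).symm

theorem level_le {n : ℕ} (hn : ∀ i, gen e c i ^ 2 ^ n = 1)
    (m : MaximalSpectrum (RootAlgebra K e c)) : level m ≤ n := by
  have : ∀ i, Ideal.Quotient.mk m.asIdeal (gen e c i) ^ 2 ^ n = 1 := fun i => by
    rw [← map_pow, hn, map_one]
  exact (torsionLevel_le_iff this n).2 this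

theorem finrank_quotient {n : ℕ} (hn : ∀ i, gen e c i ^ 2 ^ n = 1) {d : ℕ → ℕ}
    (hd : HasCyclotomicDegrees K d)
    (m : MaximalSpectrum (RootAlgebra K e c)) :
    finrank K (RootAlgebra K e c ⧸ m.asIdeal) = d (level m) := by
  let _ := Ideal.Quotient.field m.asIdeal
  have h : ∀ i, Ideal.Quotient.mk m.asIdeal (gen e c i) ^ 2 ^ n = 1 := fun i => by
    rw [← map_pow, hn, map_one]
  have htop : Algebra.adjoin K (Set.range fun i => Ideal.Quotient.mk m.asIdeal (gen e c i)) = ⊤ := by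
    have h := congrArg (Subalgebra.map (Ideal.Quotient.mkₐ K m.asIdeal)) (adjoin_gen (e := e) (c := c))
    rw [AlgHom.map_adjoin, ← Set.range_comp, Algebra.map_top,
      (AlgHom.range_eq_top _).2 (Ideal.Quotient.mkₐ_surjective K _)] at h
    exact h
  obtain ⟨ζ, hζ, hζ'⟩ := exists_isPrimitiveRoot_adjoin_eq_top (K := K) h htop
  exact hd _ ζ _ hζ hζ'

/-- The number of solutions of the defining equations, of level `k`, in an algebraic closure. -/
noncomputable def levelCount (K : Type u) [Field K] (e : ι → ℕ) (c : ι → K) (k : ℕ) : ℕ :=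
  Nat.card {v : ι → AlgebraicClosure K //
    (∀ i, v i ^ e i = algebraMap K _ (c i)) ∧ torsionLevel v = k}

/-- Each maximal ideal of level `k` is the kernel of exactly `d k` homomorphisms, which are
solutions of the equations. -/
theorem card_level_mul [PerfectField K] [Module.Finite K (RootAlgebra K e c)]
    [Fintype (MaximalSpectrum (RootAlgebra K e c))]
    {n : ℕ} (hn : ∀ i, gen e c i ^ 2 ^ n = 1) {d : ℕ → ℕ}
    (hd : HasCyclotomicDegrees K d) (k : ℕ) :
    (Finset.univ.filter fun m : MaximalSpectrum (RootAlgebra K e c) => level m = k).card * d k =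
      levelCount K e c k := by
  have h := sum_finrank_quotient_maximal (K := K) (fun m : MaximalSpectrum (RootAlgebra K e c) => level m = k)
  rw [Finset.sum_congr rfl fun m hm => (finrank_quotient hn hd m).trans
    (congrArg d (Finset.mem_filter.1 hm).2), Finset.sum_const, smul_eq_mul] at h
  rw [h, levelCount]
  simp only [level_kerMaximal]
  refine Nat.card_congr (((algHomEquiv (AlgebraicClosure K)).subtypeEquiv
    (q := fun v => torsionLevel v.1 = k) fun φ => ?_).trans
    (Equiv.subtypeSubtypeEquivSubtypeInter _ (fun v => torsionLevel v = k)))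
  rw [algHomEquiv_apply]

/-- The number of solutions of the defining equations, of level at most `k`. -/
noncomputable def levelCountLE [Fintype ι] (K : Type u) [Field K] (e : ι → ℕ) (c : ι → K) (k : ℕ) : ℕ :=
  ∏ i, Nat.card {x : AlgebraicClosure K // x ^ e i = algebraMap K _ (c i) ∧ x ^ 2 ^ k = 1}

/-- Unlike level exactly `k`, level at most `k` is a condition on each coordinate separately, so the
count is a product. Exact levels are then obtained as differences. -/
theorem card_le_level [Fintype ι] {n : ℕ} (hn : ∀ i, gen e c i ^ 2 ^ n = 1) (k : ℕ) :
    Nat.card {v : ι → AlgebraicClosure K //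
      (∀ i, v i ^ e i = algebraMap K _ (c i)) ∧ torsionLevel v ≤ k} = levelCountLE K e c k := by
  rw [levelCountLE, ← Nat.card_pi]
  refine Nat.card_congr ((Equiv.subtypeEquivRight fun v => ?_).trans
    (Equiv.subtypePiEquivPi (p := fun i (x : AlgebraicClosure K) =>
      x ^ e i = algebraMap K _ (c i) ∧ x ^ 2 ^ k = 1)))
  rw [forall_and]
  refine and_congr_right fun hv => torsionLevel_le_iff (n := n) (fun i => ?_) k
  -- An arbitrary solution is the image of the generators under a homomorphism, so it inherits their
  -- torsion bound.
  have h := (algHomEquiv (AlgebraicClosure K)).apply_symm_apply ⟨v, hv⟩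
  have h' := congrFun (congrArg Subtype.val h) i
  rw [algHomEquiv_apply] at h'
  dsimp only at h'
  rw [← h', ← map_pow, hn, map_one]

theorem levelCount_zero [Fintype ι] {n : ℕ} (hn : ∀ i, gen e c i ^ 2 ^ n = 1) :
    levelCount K e c 0 = levelCountLE K e c 0 := by
  rw [← card_le_level hn, levelCount]
  simp only [nonpos_iff_eq_zero]

theorem levelCount_succ [Fintype ι] (he : ∀ i, e i ≠ 0) {n : ℕ} (hn : ∀ i, gen e c i ^ 2 ^ n = 1) (k : ℕ) :
    levelCount K e c (k + 1) + levelCountLE K e c k = levelCountLE K e c (k + 1) := by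
  have := finite (c := c) he
  have hfin : Finite {v : ι → AlgebraicClosure K // ∀ i, v i ^ e i = algebraMap K _ (c i)} :=
    Finite.of_equiv _ (algHomEquiv (AlgebraicClosure K))
  -- Finiteness is needed for `Nat.card` to be additive; it comes from the finite dimension of the
  -- algebra.
  have hfin' : ∀ p : (ι → AlgebraicClosure K) → Prop,
      Finite {v : ι → AlgebraicClosure K // (∀ i, v i ^ e i = algebraMap K _ (c i)) ∧ p v} :=
    fun p => Finite.of_injective
      (fun v => (⟨v.1, v.2.1⟩ : {v : ι → AlgebraicClosure K // ∀ i, v i ^ e i = algebraMap K _ (c i)}))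
      fun v w h => Subtype.ext (Subtype.mk.inj h)
  rw [← card_le_level hn, ← card_le_level hn, levelCount]
  have := hfin' fun v => torsionLevel v = k + 1
  have := hfin' fun v => torsionLevel v ≤ k
  rw [← Nat.card_sum]
  classical
  refine Nat.card_congr ((subtypeOrEquiv _ _ ?_).symm.trans (Equiv.subtypeEquivRight fun v => ?_))
  · rw [Pi.disjoint_iff]
    intro v
    rw [Prop.disjoint_iff]
    grind
  · grind

theorem card_maximalSpectrum [Fintype (MaximalSpectrum (RootAlgebra K e c))]
    {n : ℕ} (hn : ∀ i, gen e c i ^ 2 ^ n = 1) :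
    Fintype.card (MaximalSpectrum (RootAlgebra K e c)) = ∑ k ∈ Finset.range (n + 1),
      (Finset.univ.filter fun m : MaximalSpectrum (RootAlgebra K e c) => level m = k).card :=
  Finset.card_eq_sum_card_fiberwise fun m _ => by
    simpa [Nat.lt_succ_iff] using level_le hn m

theorem sum_finrank_quotient [PerfectField K] [Module.Finite K (RootAlgebra K e c)] [Fintype ι]
    [Fintype (MaximalSpectrum (RootAlgebra K e c))]
    {n : ℕ} (hn : ∀ i, gen e c i ^ 2 ^ n = 1) :
    ∑ m : MaximalSpectrum (RootAlgebra K e c), finrank K (RootAlgebra K e c ⧸ m.asIdeal) =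
      levelCountLE K e c n := by
  have h := sum_finrank_quotient_maximal (K := K) (fun m : MaximalSpectrum (RootAlgebra K e c) => level m ≤ n)
  rw [Finset.filter_true_of_mem fun m _ => level_le hn m] at h
  rw [h, ← card_le_level hn]
  simp only [level_kerMaximal]
  refine Nat.card_congr (((algHomEquiv (AlgebraicClosure K)).subtypeEquiv
    (q := fun v => torsionLevel v.1 ≤ n) fun φ => ?_).trans
    (Equiv.subtypeSubtypeEquivSubtypeInter _ (fun v => torsionLevel v ≤ n)))
  rw [algHomEquiv_apply]

end RootAlgebra

/-! ### Normal form and universal property of the group -/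

namespace D3Group

open scoped commutatorElement

variable {m₁ m₂ : ℕ}

local notation "gx" => (PresentedGroup.of D3Gen.x : PresentedGroup (D3Rels m₁ m₂))
local notation "gy" => (PresentedGroup.of D3Gen.y : PresentedGroup (D3Rels m₁ m₂))
local notation "gs" => (PresentedGroup.of D3Gen.t₁ : PresentedGroup (D3Rels m₁ m₂))
local notation "gt" => (PresentedGroup.of D3Gen.t₂ : PresentedGroup (D3Rels m₁ m₂))

theorem relation {w : FreeGroup D3Gen} (h : w ∈ D3Rels m₁ m₂) :
    PresentedGroup.mk (D3Rels m₁ m₂) w = 1 := PresentedGroup.one_of_mem h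

theorem x_sq : gx ^ 2 = 1 := by
  simpa using! relation (m₁ := m₁) (m₂ := m₂) (w := FreeGroup.of D3Gen.x ^ 2) (by simp [D3Rels])

theorem s_pow : gs ^ 2 ^ m₁ = 1 :=
  relation (m₁ := m₁) (m₂ := m₂) (w := FreeGroup.of D3Gen.t₁ ^ 2 ^ m₁) (by simp [D3Rels])

theorem t_pow : gt ^ 2 ^ m₂ = 1 :=
  relation (m₁ := m₁) (m₂ := m₂) (w := FreeGroup.of D3Gen.t₂ ^ 2 ^ m₂) (by simp [D3Rels])

theorem y_sq : gy ^ 2 = gt :=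
  mul_inv_eq_one.1 (relation (m₁ := m₁) (m₂ := m₂)
    (w := FreeGroup.of D3Gen.y ^ 2 * (FreeGroup.of D3Gen.t₂)⁻¹) (by simp [D3Rels]))

theorem y_pow : gy ^ 2 ^ (m₂ + 1) = 1 := by
  rw [pow_succ', pow_mul, y_sq, t_pow]

theorem commute_s_x : Commute gs gx :=
  commutatorElement_eq_one_iff_commute.1 (relation (m₁ := m₁) (m₂ := m₂)
    (w := ⁅FreeGroup.of D3Gen.t₁, FreeGroup.of D3Gen.x⁆) (by simp [D3Rels]))

theorem commute_s_y : Commute gs gy :=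
  commutatorElement_eq_one_iff_commute.1 (relation (m₁ := m₁) (m₂ := m₂)
    (w := ⁅FreeGroup.of D3Gen.t₁, FreeGroup.of D3Gen.y⁆) (by simp [D3Rels]))

theorem x_mul_y : gx * gy = gs ^ 2 ^ (m₁ - 1) * gy * gx := by
  have h : ⁅gx, gy⁆ = gs ^ 2 ^ (m₁ - 1) :=
    mul_inv_eq_one.1 (relation (m₁ := m₁) (m₂ := m₂) (w := ⁅FreeGroup.of D3Gen.x,
      FreeGroup.of D3Gen.y⁆ * (FreeGroup.of D3Gen.t₁ ^ 2 ^ (m₁ - 1))⁻¹) (by simp [D3Rels]))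
  rw [← h, commutatorElement_def]
  group

/-- The generator t₂ is y², and exchanging x and y costs only a power of the central t₁, so words
can be sorted. -/
theorem exists_normal_form (g : PresentedGroup (D3Rels m₁ m₂)) :
    ∃ i j k : ℕ, g = gx ^ i * gy ^ j * gs ^ k := by
  have hmem : g ∈ Submonoid.closure ({gx, gy, gs} : Set (PresentedGroup (D3Rels m₁ m₂))) := by
    -- The generators have finite order, so positive words suffice.
    have hinv : ∀ (a : PresentedGroup (D3Rels m₁ m₂)) (n : ℕ), a ^ n = 1 → n ≠ 0 →
        a ∈ Submonoid.closure ({gx, gy, gs} : Set (PresentedGroup (D3Rels m₁ m₂))) →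
        a⁻¹ ∈ Submonoid.closure ({gx, gy, gs} : Set (PresentedGroup (D3Rels m₁ m₂))) := by
      intro a n hn h0 ha
      have : a⁻¹ = a ^ (n - 1) := by
        rw [inv_eq_iff_mul_eq_one, ← pow_succ', Nat.sub_add_cancel (Nat.pos_of_ne_zero h0), hn]
      rw [this]
      exact pow_mem ha _
    have hx := Submonoid.subset_closure (s := ({gx, gy, gs} : Set (PresentedGroup (D3Rels m₁ m₂))))
      (show gx ∈ _ by simp)
    have hy := Submonoid.subset_closure (s := ({gx, gy, gs} : Set (PresentedGroup (D3Rels m₁ m₂))))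
      (show gy ∈ _ by simp)
    have hs := Submonoid.subset_closure (s := ({gx, gy, gs} : Set (PresentedGroup (D3Rels m₁ m₂))))
      (show gs ∈ _ by simp)
    have htop : g ∈ Subgroup.closure (Set.range
      (PresentedGroup.of : D3Gen → PresentedGroup (D3Rels m₁ m₂))) := by
      rw [PresentedGroup.closure_range_of]; trivial
    induction htop using Subgroup.closure_induction'' with
    | mem a ha =>
      obtain ⟨_ | _ | _ | _, rfl⟩ := ha
      · exact hx
      · exact hy
      · exact hs
      · rw [← y_sq]; exact pow_mem hy 2
    | inv_mem a ha =>
      obtain ⟨_ | _ | _ | _, rfl⟩ := ha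
      · exact hinv _ 2 x_sq two_ne_zero hx
      · exact hinv _ _ y_pow (by positivity) hy
      · exact hinv _ _ s_pow (by positivity) hs
      · exact hinv _ _ t_pow (by positivity) (by rw [← y_sq]; exact pow_mem hy 2)
    | one => exact one_mem _
    | mul a b _ _ ha hb => exact mul_mem ha hb
  induction hmem using Submonoid.closure_induction_left with
  | one => exact ⟨0, 0, 0, by simp⟩
  | mul_left a ha b _ hb =>
    obtain ⟨i, j, k, rfl⟩ := hb
    obtain rfl | rfl | rfl : a = gx ∨ a = gy ∨ a = gs := by simpa using ha
    · exact ⟨i + 1, j, k, by rw [pow_succ']; simp only [mul_assoc]⟩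
    -- `gs ^ w` is the inverse of the commutator, written with a natural exponent.
    · obtain ⟨w, hw⟩ : ∃ w, gs ^ w * gs ^ 2 ^ (m₁ - 1) = 1 :=
        ⟨2 ^ (m₁ - 1) * (2 ^ m₁ - 1), by
          rw [← pow_add, ← Nat.mul_succ, Nat.succ_eq_add_one,
            Nat.sub_add_cancel Nat.one_le_two_pow, mul_comm, pow_mul, s_pow, one_pow]⟩
      have hyx : gy * gx = gs ^ w * (gx * gy) := by
        rw [x_mul_y, ← mul_assoc, ← mul_assoc, hw, one_mul]
      have key : ∀ i : ℕ, ∃ l : ℕ, gy * gx ^ i = gs ^ l * (gx ^ i * gy) := by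
        intro i
        induction i with
        | zero => exact ⟨0, by simp⟩
        | succ i ih =>
          obtain ⟨l, hl⟩ := ih
          refine ⟨l + w, ?_⟩
          have hc : Commute (gs ^ w) (gx ^ i) := commute_s_x.pow_pow _ _
          calc gy * gx ^ (i + 1) = (gy * gx ^ i) * gx := by rw [pow_succ, mul_assoc]
            _ = gs ^ l * gx ^ i * (gy * gx) := by rw [hl]; simp only [mul_assoc]
            _ = gs ^ l * (gx ^ i * gs ^ w) * (gx * gy) := by
              rw [hyx]; simp only [mul_assoc]
            _ = _ := by rw [← hc.eq, pow_add, pow_succ]; simp only [mul_assoc]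
      obtain ⟨l, hl⟩ := key i
      have hc : Commute (gs ^ l) (gx ^ i * gy ^ (j + 1)) :=
        (commute_s_x.pow_pow _ _).mul_right (commute_s_y.pow_pow _ _)
      refine ⟨i, j + 1, l + k, ?_⟩
      calc gy * (gx ^ i * gy ^ j * gs ^ k) = (gy * gx ^ i) * gy ^ j * gs ^ k := by
            simp only [mul_assoc]
        _ = gs ^ l * (gx ^ i * gy ^ (j + 1)) * gs ^ k := by
            rw [hl, pow_succ']; simp only [mul_assoc]
        _ = _ := by rw [hc.eq, pow_add (gs)]; simp only [mul_assoc]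
    · have hc : Commute gs (gx ^ i * gy ^ j) :=
        (commute_s_x.pow_right _).mul_right (commute_s_y.pow_right _)
      refine ⟨i, j, k + 1, ?_⟩
      rw [← mul_assoc, hc.eq, pow_succ', mul_assoc]

/-- An upper bound is enough: the surjection onto the product of components later supplies the
reverse inequality. -/
theorem finite_and_card_le : Finite (PresentedGroup (D3Rels m₁ m₂)) ∧
    Nat.card (PresentedGroup (D3Rels m₁ m₂)) ≤ 2 ^ (m₁ + m₂ + 2) := by
  have hsurj : Function.Surjective (fun p : Fin 2 × Fin (2 ^ (m₂ + 1)) × Fin (2 ^ m₁) =>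
      gx ^ (p.1 : ℕ) * gy ^ (p.2.1 : ℕ) * gs ^ (p.2.2 : ℕ)) := by
    intro g
    obtain ⟨i, j, k, rfl⟩ := exists_normal_form g
    refine ⟨⟨⟨i % 2, Nat.mod_lt _ (by positivity)⟩, ⟨j % 2 ^ (m₂ + 1), Nat.mod_lt _ (by positivity)⟩,
      ⟨k % 2 ^ m₁, Nat.mod_lt _ (by positivity)⟩⟩, ?_⟩
    dsimp only
    rw [← pow_eq_pow_mod i x_sq, ← pow_eq_pow_mod j y_pow, ← pow_eq_pow_mod k s_pow]
  refine ⟨Finite.of_surjective _ hsurj, (Nat.card_le_card_of_surjective _ hsurj).trans_eq ?_⟩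
  simp only [Nat.card_prod, Nat.card_fin]
  ring

theorem exists_monoidHom {A : Type*} [Monoid A] (hm : 1 ≤ m₁) {X Y S : A} (hX : X ^ 2 = 1)
    (hY : Y ^ 2 ^ (m₂ + 1) = 1) (hS : S ^ 2 ^ m₁ = 1) (hSX : Commute S X) (hSY : Commute S Y)
    (hXY : X * Y = S ^ 2 ^ (m₁ - 1) * Y * X) :
    ∃ f : PresentedGroup (D3Rels m₁ m₂) →* A, f gx = X ∧ f gy = Y ∧ f gs = S ∧ f gt = Y ^ 2 := by
  obtain ⟨x, rfl⟩ := IsUnit.of_pow_eq_one hX two_ne_zero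
  obtain ⟨y, rfl⟩ := IsUnit.of_pow_eq_one hY (by positivity)
  obtain ⟨s, rfl⟩ := IsUnit.of_pow_eq_one hS (by positivity)
  have hX' : x ^ 2 = 1 := Units.ext (by simpa using hX)
  have hY' : y ^ 2 ^ (m₂ + 1) = 1 := Units.ext (by simpa using hY)
  have hS' : s ^ 2 ^ m₁ = 1 := Units.ext (by simpa using hS)
  have hSX' : Commute s x := Units.ext (by simpa using hSX.eq)
  have hSY' : Commute s y := Units.ext (by simpa using hSY.eq)
  have hXY' : ⁅x, y⁆ * (s ^ 2 ^ (m₁ - 1))⁻¹ = 1 := by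
    rw [mul_inv_eq_one, commutatorElement_def, mul_inv_eq_iff_eq_mul, mul_inv_eq_iff_eq_mul]
    exact Units.ext (by simpa using hXY)
  have hz : s ^ 2 ^ (m₁ - 1) * s ^ 2 ^ (m₁ - 1) = 1 := by
    rw [← pow_add, ← two_mul, ← pow_succ', Nat.sub_add_cancel hm, hS']
  -- Moving x past y twice produces the square of the commutator, which is 1; hence centrality of t₂
  -- need not be assumed.
  have hyx : Commute (y ^ 2) x := by
    have hxy : x * y = s ^ 2 ^ (m₁ - 1) * y * x := Units.ext (by simpa using hXY)
    have hc : Commute (s ^ 2 ^ (m₁ - 1)) y := hSY'.pow_left _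
    refine Eq.symm ?_
    calc x * y ^ 2 = x * y * y := by rw [pow_two, mul_assoc]
      _ = s ^ 2 ^ (m₁ - 1) * y * (x * y) := by rw [hxy]; simp only [mul_assoc, hxy]
      _ = s ^ 2 ^ (m₁ - 1) * (y * s ^ 2 ^ (m₁ - 1)) * y * x := by rw [hxy]; simp only [mul_assoc]
      _ = _ := by rw [← hc.eq, ← mul_assoc, hz, one_mul, pow_two]
  have hT : (y ^ 2) ^ 2 ^ m₂ = 1 := by rw [← pow_mul, ← pow_succ', hY']
  let f : D3Gen → Aˣ := fun g => match g with
    | .x => x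
    | .y => y
    | .t₁ => s
    | .t₂ => y ^ 2
  have hf : ∀ r ∈ D3Rels m₁ m₂, FreeGroup.lift f r = 1 := by
    intro r hr
    simp only [D3Rels, Set.mem_insert_iff, Set.mem_singleton_iff] at hr
    rcases hr with rfl | rfl | rfl | rfl | rfl | rfl | rfl | rfl | rfl | rfl <;>
      simp only [map_mul, map_pow, map_inv, map_commutatorElement, FreeGroup.lift_apply_of, f, hX',
        hS', hT, hXY', mul_inv_cancel, commutatorElement_eq_one_iff_commute]
    · exact hSX'
    · exact hSY'
    · exact hSY'.pow_right 2
    · exact hyx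
    · exact (Commute.refl y).pow_left 2
  refine ⟨(Units.coeHom A).comp (PresentedGroup.toGroup hf), ?_, ?_, ?_, ?_⟩ <;>
    simp [f]

end D3Group

/-! ### Quaternion algebras over the residue fields -/

/-- The map from an algebra to the product of its residue fields. -/
noncomputable def toResidueFields (K R : Type*) [Field K] [CommRing R] [Algebra K R] :
    R →ₐ[K] ∀ m : MaximalSpectrum R, R ⧸ m.asIdeal :=
  AlgHom.pi fun m => Ideal.Quotient.mkₐ K m.asIdeal

theorem toResidueFields_surjective (K R : Type*) [Field K] [CommRing R] [Algebra K R]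
    [Module.Finite K R] : Function.Surjective (toResidueFields K R) := by
  have : IsArtinianRing R := IsArtinianRing.of_finite K R
  intro q
  obtain ⟨r, hr⟩ := Ideal.pi_quotient_surjective (I := fun m : MaximalSpectrum R => m.asIdeal)
    (fun m m' h => Ideal.isCoprime_of_isMaximal fun h' => h (MaximalSpectrum.ext h')) q
  exact ⟨r, funext hr⟩

section Quaternion

variable {K R : Type*} [Field K] [CommRing R] [Algebra K R]

/-- The product of the quaternion algebras `(1, t)` over the residue fields. -/
abbrev ResidueQuaternions (t : R) : Type _ :=
  ∀ m : MaximalSpectrum R, QuaternionAlgebra (R ⧸ m.asIdeal) 1 0 (Ideal.Quotient.mk m.asIdeal t)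

namespace ResidueQuaternions

/-- The scalars. -/
noncomputable def scalar (K : Type*) [Field K] [Algebra K R] (t : R) : R →ₐ[K] ResidueQuaternions t :=
  AlgHom.pi fun m => (IsScalarTower.toAlgHom K (R ⧸ m.asIdeal) _).comp
    (Ideal.Quotient.mkₐ K m.asIdeal)

/-- The first basis quaternion in each component. -/
def unitI (t : R) : ResidueQuaternions t := fun _ => ⟨0, 1, 0, 0⟩

/-- The second basis quaternion in each component. -/
def unitJ (t : R) : ResidueQuaternions t := fun _ => ⟨0, 0, 1, 0⟩

theorem scalar_apply (t r : R) (m : MaximalSpectrum R) :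
    scalar K t r m = ⟨Ideal.Quotient.mk m.asIdeal r, 0, 0, 0⟩ := rfl

theorem unitI_sq (t : R) : unitI t ^ 2 = 1 := by
  ext m <;> simp [unitI, pow_two]

theorem unitJ_sq (t : R) : unitJ t ^ 2 = scalar K t t := by
  ext m <;> simp [unitJ, pow_two, scalar_apply]

theorem unitI_mul_unitJ (t : R) : unitI t * unitJ t = -(unitJ t * unitI t) := by
  ext m <;> simp [unitI, unitJ]

theorem scalar_commute (t r : R) (q : ResidueQuaternions t) : Commute (scalar K t r) q := by
  ext m <;> simp [scalar_apply, mul_comm]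

/-- By the Chinese remainder theorem each family of coordinates over the residue fields lifts to one
element of `R`. -/
theorem eq_top_of_mem [Module.Finite K R] {t : R} {S : Subalgebra K (ResidueQuaternions t)}
    (hr : ∀ r, scalar K t r ∈ S) (hI : unitI t ∈ S) (hJ : unitJ t ∈ S) : S = ⊤ := by
  rw [eq_top_iff]
  rintro q -
  obtain ⟨a, ha⟩ := toResidueFields_surjective K R fun m => (q m).re
  obtain ⟨b, hb⟩ := toResidueFields_surjective K R fun m => (q m).imI
  obtain ⟨c, hc⟩ := toResidueFields_surjective K R fun m => (q m).imJ
  obtain ⟨d, hd⟩ := toResidueFields_surjective K R fun m => (q m).imK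
  have : q = scalar K t a + scalar K t b * unitI t + scalar K t c * unitJ t +
      scalar K t d * (unitI t * unitJ t) := by
    ext m
    · simpa [scalar_apply, unitI, unitJ] using! (congrFun ha m).symm
    · simpa [scalar_apply, unitI, unitJ] using! (congrFun hb m).symm
    · simpa [scalar_apply, unitI, unitJ] using! (congrFun hc m).symm
    · simpa [scalar_apply, unitI, unitJ] using! (congrFun hd m).symm
  rw [this]
  exact add_mem (add_mem (add_mem (hr a) (mul_mem (hr b) hI)) (mul_mem (hr c) hJ))
    (mul_mem (hr d) (mul_mem hI hJ))

end ResidueQuaternions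

end Quaternion

/-- The elements (1 + z)/2 and (1 - z)/2 map to (1, 0) and (0, 1). -/
theorem AlgHom.prod_surjective_of_neg_one {K A B C : Type*} [Field K] (h2 : (2 : K) ≠ 0) [Ring A]
    [Algebra K A] [Ring B] [Algebra K B] [Ring C] [Algebra K C] {f : A →ₐ[K] B} {g : A →ₐ[K] C}
    (hf : Function.Surjective f) (hg : Function.Surjective g) {z : A} (hz : f z = 1)
    (hz' : g z = -1) : Function.Surjective (f.prod g) := by
  rintro ⟨b, c⟩
  obtain ⟨a, rfl⟩ := hf b
  obtain ⟨a', rfl⟩ := hg c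
  refine ⟨(2 : K)⁻¹ • ((1 + z) * a + (1 - z) * a'), ?_⟩
  have e1 : f ((2 : K)⁻¹ • ((1 + z) * a + (1 - z) * a')) = f a := by
    simp only [map_smul, map_add, map_mul, map_sub, map_one, hz, sub_self, zero_mul, add_zero,
      one_add_one_eq_two]
    rw [inv_smul_eq_iff₀ h2, ofNat_smul_eq_nsmul K 2, nsmul_eq_mul, Nat.cast_ofNat]
  have e2 : g ((2 : K)⁻¹ • ((1 + z) * a + (1 - z) * a')) = g a' := by
    simp only [map_smul, map_add, map_mul, map_sub, map_one, hz', add_neg_cancel, zero_mul, zero_add,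
      sub_neg_eq_add, one_add_one_eq_two]
    rw [inv_smul_eq_iff₀ h2, ofNat_smul_eq_nsmul K 2, nsmul_eq_mul, Nat.cast_ofNat]
  exact Prod.ext e1 e2

section

variable {K : Type u} [Field K]

theorem ResidueQuaternions.finite {R : Type*} [CommRing R] [Algebra K R] [Module.Finite K R]
    (t : R) : Module.Finite K (ResidueQuaternions t) := by
  have : IsArtinianRing R := IsArtinianRing.of_finite K R
  have : ∀ m : MaximalSpectrum R, Module.Finite K
      (QuaternionAlgebra (R ⧸ m.asIdeal) 1 0 (Ideal.Quotient.mk m.asIdeal t)) :=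
    fun m => Module.Finite.trans (R ⧸ m.asIdeal) _
  exact Module.Finite.pi

theorem ResidueQuaternions.finrank_eq {R : Type*} [CommRing R] [Algebra K R] [Module.Finite K R]
    [Fintype (MaximalSpectrum R)] (t : R) : finrank K (ResidueQuaternions t) =
      (∑ m : MaximalSpectrum R, finrank K (R ⧸ m.asIdeal)) * 4 := by
  have h (m : MaximalSpectrum R) :
      finrank K (QuaternionAlgebra (R ⧸ m.asIdeal) 1 0 (Ideal.Quotient.mk m.asIdeal t)) =
        finrank K (R ⧸ m.asIdeal) * 4 := by
    let _ := Ideal.Quotient.field m.asIdeal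
    rw [← finrank_mul_finrank K (R ⧸ m.asIdeal), QuaternionAlgebra.finrank_eq_four]
  have : ∀ m : MaximalSpectrum R, Module.Finite K
      (QuaternionAlgebra (R ⧸ m.asIdeal) 1 0 (Ideal.Quotient.mk m.asIdeal t)) :=
    fun m => Module.Finite.trans (R ⧸ m.asIdeal) _
  rw [finrank_pi_fintype, Finset.sum_congr rfl fun m _ => h m, Finset.sum_mul]

/-- Surjectivity gives one inequality of dimensions and `hA` the other, so the map is bijective;
semisimplicity need not be known beforehand. -/
theorem isSumOfFieldsAndQuaternions_of_surjective (h2 : (2 : K) ≠ 0) {A : Type*} [Ring A]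
    [Algebra K A] [Module.Finite K A] {R S : Type u} [CommRing R] [Algebra K R]
    [Module.Finite K R] [CommRing S] [Algebra K S] [Module.Finite K S]
    [Fintype (MaximalSpectrum R)] [Fintype (MaximalSpectrum S)] {t : S} (ht : IsUnit t)
    {f : A →ₐ[K] R} {g : A →ₐ[K] ResidueQuaternions t} (hf : Function.Surjective f)
    (hg : Function.Surjective g) {z : A} (hz : f z = 1) (hz' : g z = -1)
    (hA : finrank K A ≤ (∑ m : MaximalSpectrum R, finrank K (R ⧸ m.asIdeal)) +
      (∑ m : MaximalSpectrum S, finrank K (S ⧸ m.asIdeal)) * 4) :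
    IsSumOfFieldsAndQuaternions K A (Fintype.card (MaximalSpectrum R))
      (Fintype.card (MaximalSpectrum S)) := by
  have := ResidueQuaternions.finite (K := K) t
  let Φ := ((toResidueFields K R).comp f).prod g
  have hs : Function.Surjective Φ :=
    AlgHom.prod_surjective_of_neg_one h2 ((toResidueFields_surjective K R).comp hf) hg
      (by rw [AlgHom.comp_apply, hz, map_one]) hz'
  rw [← ResidueQuaternions.finrank_eq t, ← finrank_pi_fintype, ← finrank_prod] at hA
  have heq := le_antisymm hA (Φ.toLinearMap.finrank_le_finrank_of_surjective hs)
  let φ := AlgEquiv.ofBijective Φ ⟨(LinearMap.injective_iff_surjective_of_finrank_eq_finrank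
    (f := Φ.toLinearMap) heq).2 hs, hs⟩
  let eR := (Fintype.equivFin (MaximalSpectrum R)).symm
  let eS := (Fintype.equivFin (MaximalSpectrum S)).symm
  refine ⟨fun i => R ⧸ (eR i).asIdeal, inferInstance, inferInstance,
    fun j => QuaternionAlgebra (S ⧸ (eS j).asIdeal) 1 0 (Ideal.Quotient.mk (eS j).asIdeal t),
    inferInstance, inferInstance, fun i => ?_, fun j => ?_, ⟨?_⟩⟩
  · exact (Ideal.Quotient.maximal_ideal_iff_isField_quotient _).1 (eR i).isMaximal
  · let _ := Ideal.Quotient.field (eS j).asIdeal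
    exact ⟨S ⧸ (eS j).asIdeal, inferInstance, inferInstance, 1,
      Ideal.Quotient.mk (eS j).asIdeal t, one_ne_zero, (ht.map _).ne_zero, ⟨AlgEquiv.refl⟩⟩
  · exact φ.trans (AlgEquiv.prodCongr
      (AlgEquiv.piCongrLeft K (fun m : MaximalSpectrum R => R ⧸ m.asIdeal) eR).symm
      (AlgEquiv.piCongrLeft K (fun m : MaximalSpectrum S =>
        QuaternionAlgebra (S ⧸ m.asIdeal) 1 0 (Ideal.Quotient.mk m.asIdeal t)) eS).symm)

end

/-! ### The abelian and the central part -/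

/-- The algebra of the abelian quotient of a group of type `D₃` by its commutator subgroup. -/
abbrev AbelianPart (K : Type u) [Field K] (m₁ m₂ : ℕ) : Type u :=
  RootAlgebra K ![2, 2 ^ (m₁ - 1), 2 ^ (m₂ + 1)] fun _ => 1

/-- The algebra of the center, with the nontrivial commutator set to `-1`. -/
abbrev CentralPart (K : Type u) [Field K] (m₁ m₂ : ℕ) : Type u :=
  RootAlgebra K ![2 ^ (m₁ - 1), 2 ^ m₂] ![-1, 1]

section Parts

variable {K : Type u} [Field K] {m₁ m₂ : ℕ}

open RootAlgebra

instance : Module.Finite K (AbelianPart K m₁ m₂) :=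
  RootAlgebra.finite fun i => by fin_cases i <;> simp

instance : Module.Finite K (CentralPart K m₁ m₂) :=
  RootAlgebra.finite fun i => by fin_cases i <;> simp

theorem pow_eq_one_of_le {M : Type*} [Monoid M] {x : M} {a b : ℕ} (h : x ^ 2 ^ a = 1) (hab : a ≤ b) :
    x ^ 2 ^ b = 1 := by
  obtain ⟨j, rfl⟩ := Nat.exists_eq_add_of_le hab
  rw [pow_add, pow_mul, h, one_pow]

/-- The crude exponent m₁+m₂+1 is chosen to serve both parts. -/
theorem AbelianPart.gen_pow_eq_one (i : Fin 3) :
    (gen _ _ i : AbelianPart K m₁ m₂) ^ 2 ^ (m₁ + m₂ + 1) = 1 := by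
  have h := gen_pow (K := K) (e := ![2, 2 ^ (m₁ - 1), 2 ^ (m₂ + 1)]) (c := fun _ => 1) i
  replace h := h.trans (map_one _)
  fin_cases i
  · exact pow_eq_one_of_le (a := 1) h (by omega)
  · exact pow_eq_one_of_le (a := m₁ - 1) h (by omega)
  · exact pow_eq_one_of_le (a := m₂ + 1) h (by omega)

theorem CentralPart.gen_zero_pow : (gen _ _ 0 : CentralPart K m₁ m₂) ^ 2 ^ (m₁ - 1) = -1 := by
  have h := gen_pow (K := K) (e := ![2 ^ (m₁ - 1), 2 ^ m₂]) (c := ![-1, 1]) 0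
  simpa using h

theorem CentralPart.gen_one_pow : (gen _ _ 1 : CentralPart K m₁ m₂) ^ 2 ^ m₂ = 1 := by
  have h := gen_pow (K := K) (e := ![2 ^ (m₁ - 1), 2 ^ m₂]) (c := ![-1, 1]) 1
  simpa using h

theorem CentralPart.gen_zero_pow' (hm : 1 ≤ m₁) : (gen _ _ 0 : CentralPart K m₁ m₂) ^ 2 ^ m₁ = 1 := by
  have h : 2 ^ m₁ = 2 ^ (m₁ - 1) * 2 := by rw [← pow_succ, Nat.sub_add_cancel hm]
  rw [h, pow_mul, CentralPart.gen_zero_pow]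
  exact neg_one_sq (R := CentralPart K m₁ m₂)

theorem CentralPart.gen_pow_eq_one (hm : 1 ≤ m₁) (i : Fin 2) :
    (gen _ _ i : CentralPart K m₁ m₂) ^ 2 ^ (m₁ + m₂ + 1) = 1 := by
  fin_cases i
  · exact pow_eq_one_of_le (CentralPart.gen_zero_pow' hm) (by omega)
  · exact pow_eq_one_of_le CentralPart.gen_one_pow (by omega)

theorem AbelianPart.levelCountLE_eq (h2 : (2 : K) ≠ 0) (k : ℕ) :
    levelCountLE K ![2, 2 ^ (m₁ - 1), 2 ^ (m₂ + 1)] (fun _ => 1) k =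
      2 ^ (min 1 k + min (m₁ - 1) k + min (m₂ + 1) k) := by
  have h2' : (2 : AlgebraicClosure K) ≠ 0 := by
    rw [← map_ofNat (algebraMap K (AlgebraicClosure K)) 2]
    exact (map_ne_zero (algebraMap K (AlgebraicClosure K))).2 h2
  rw [levelCountLE, Fin.prod_univ_three, pow_add _ (min 1 k + _), pow_add _ (min 1 k)]
  simp only [map_one]
  congr 1
  · congr 1
    · exact card_root_of_pow_eq_one_and h2' 1 k
    · exact card_root_of_pow_eq_one_and h2' (m₁ - 1) k
  · exact card_root_of_pow_eq_one_and h2' (m₂ + 1) k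

theorem CentralPart.levelCountLE_eq (h2 : (2 : K) ≠ 0) (k : ℕ) :
    levelCountLE K ![2 ^ (m₁ - 1), 2 ^ m₂] ![-1, 1] k =
      if m₁ - 1 < k then 2 ^ (m₁ - 1 + min m₂ k) else 0 := by
  have h2' : (2 : AlgebraicClosure K) ≠ 0 := by
    rw [← map_ofNat (algebraMap K (AlgebraicClosure K)) 2]
    exact (map_ne_zero (algebraMap K (AlgebraicClosure K))).2 h2
  have h := card_root_of_pow_eq_neg_one_and h2' (m₁ - 1) k
  have h' := card_root_of_pow_eq_one_and h2' m₂ k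
  rw [levelCountLE, Fin.prod_univ_two]
  simp only [Matrix.cons_val_zero, Matrix.cons_val_one, map_one, map_neg]
  rw [h, h']
  split_ifs
  · rw [pow_add]
  · rw [zero_mul]

end Parts

/-! ### Decomposition of the group algebra -/

namespace D3Group

variable {K : Type u} [Field K] {m₁ m₂ : ℕ}

open RootAlgebra ResidueQuaternions

theorem exists_surjective_abelianPart (hm : 1 ≤ m₁) :
    ∃ f : MonoidAlgebra K (PresentedGroup (D3Rels m₁ m₂)) →ₐ[K]
        AbelianPart K m₁ m₂,
      Function.Surjective f ∧
        f (MonoidAlgebra.of K _ (PresentedGroup.of D3Gen.t₁ ^ 2 ^ (m₁ - 1))) = 1 := by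
  have h := gen_pow (K := K) (e := ![2, 2 ^ (m₁ - 1), 2 ^ (m₂ + 1)]) (c := fun _ => 1)
  simp only [map_one] at h
  have h1 : (gen _ _ 1 : AbelianPart K m₁ m₂) ^ 2 ^ (m₁ - 1) = 1 := h 1
  obtain ⟨f, hfx, hfy, hfs, -⟩ := exists_monoidHom (m₂ := m₂) hm (h 0) (h 2)
    (pow_eq_one_of_le (h 1) (Nat.sub_le _ _)) (Commute.all _ _) (Commute.all _ _) (by
      rw [h1, one_mul, mul_comm])
  refine ⟨MonoidAlgebra.lift K _ _ f, ?_, ?_⟩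
  · rw [← AlgHom.range_eq_top, eq_top_iff, ← adjoin_gen, Algebra.adjoin_le_iff]
    rintro _ ⟨i, rfl⟩
    fin_cases i
    · exact ⟨MonoidAlgebra.of K _ (PresentedGroup.of D3Gen.x), (MonoidAlgebra.lift_of _ _).trans hfx⟩
    · exact ⟨MonoidAlgebra.of K _ (PresentedGroup.of D3Gen.t₁), (MonoidAlgebra.lift_of _ _).trans hfs⟩
    · exact ⟨MonoidAlgebra.of K _ (PresentedGroup.of D3Gen.y), (MonoidAlgebra.lift_of _ _).trans hfy⟩
  · rw [MonoidAlgebra.lift_of, map_pow, hfs, h1]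

/-- The map sends x, y to the basis quaternions i, j and t₁ to a scalar; then t₂ goes to j², which
is the scalar t₂. -/
theorem exists_surjective_quaternions (hm : 1 ≤ m₁) :
    ∃ f : MonoidAlgebra K (PresentedGroup (D3Rels m₁ m₂)) →ₐ[K]
        ResidueQuaternions (gen _ _ 1 : CentralPart K m₁ m₂),
      Function.Surjective f ∧
        f (MonoidAlgebra.of K _ (PresentedGroup.of D3Gen.t₁ ^ 2 ^ (m₁ - 1))) = -1 := by
  have hz : scalar K (gen _ _ 1 : CentralPart K m₁ m₂) (gen _ _ 0) ^ 2 ^ (m₁ - 1) = -1 := by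
    rw [← map_pow, CentralPart.gen_zero_pow, map_neg, map_one]
  have hJ := unitJ_sq (K := K) (gen _ _ 1 : CentralPart K m₁ m₂)
  obtain ⟨f, hfx, hfy, hfs, hft⟩ := exists_monoidHom (m₂ := m₂) hm
    (unitI_sq (gen _ _ 1 : CentralPart K m₁ m₂)) (Y := unitJ _)
    (by rw [pow_succ', pow_mul, hJ, ← map_pow, CentralPart.gen_one_pow, map_one])
    (S := scalar K _ (gen _ _ 0))
    (by rw [← map_pow, CentralPart.gen_zero_pow' hm, map_one])
    (scalar_commute _ _ _) (scalar_commute _ _ _)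
    (by rw [hz, unitI_mul_unitJ, neg_one_mul, neg_mul])
  refine ⟨MonoidAlgebra.lift K _ _ f, ?_, ?_⟩
  · rw [← AlgHom.range_eq_top]
    refine eq_top_of_mem (fun r => ?_) ?_ ?_
    · have : Algebra.adjoin K (Set.range (gen (K := K) ![2 ^ (m₁ - 1), 2 ^ m₂] ![-1, 1])) ≤
          (MonoidAlgebra.lift K _ _ f).range.comap (scalar K _) := by
        rw [Algebra.adjoin_le_iff]
        rintro _ ⟨i, rfl⟩
        fin_cases i
        · exact ⟨MonoidAlgebra.of K _ (PresentedGroup.of D3Gen.t₁),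
            (MonoidAlgebra.lift_of _ _).trans hfs⟩
        · exact ⟨MonoidAlgebra.of K _ (PresentedGroup.of D3Gen.t₂),
            (MonoidAlgebra.lift_of _ _).trans (hft.trans hJ)⟩
      rw [adjoin_gen] at this
      exact this (x := r) trivial
    · exact ⟨MonoidAlgebra.of K _ (PresentedGroup.of D3Gen.x), (MonoidAlgebra.lift_of _ _).trans hfx⟩
    · exact ⟨MonoidAlgebra.of K _ (PresentedGroup.of D3Gen.y), (MonoidAlgebra.lift_of _ _).trans hfy⟩
  · rw [MonoidAlgebra.lift_of, map_pow, hfs, hz]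

theorem isSumOfFieldsAndQuaternions [PerfectField K] (h2 : (2 : K) ≠ 0) {G : Type v} [Group G]
    (hG : IsTypeD3 m₁ m₂ G) [Fintype (MaximalSpectrum (AbelianPart K m₁ m₂))]
    [Fintype (MaximalSpectrum (CentralPart K m₁ m₂))] :
    IsSumOfFieldsAndQuaternions K (MonoidAlgebra K G)
      (Fintype.card (MaximalSpectrum (AbelianPart K m₁ m₂)))
      (Fintype.card (MaximalSpectrum (CentralPart K m₁ m₂))) := by
  obtain ⟨hm, -, ⟨e⟩⟩ := hG
  obtain ⟨f, hf, hz⟩ := exists_surjective_abelianPart (K := K) (m₂ := m₂) hm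
  obtain ⟨g, hg, hz'⟩ := exists_surjective_quaternions (K := K) (m₂ := m₂) hm
  obtain ⟨hfin, hcard⟩ := finite_and_card_le (m₁ := m₁) (m₂ := m₂)
  have : Fintype (PresentedGroup (D3Rels m₁ m₂)) := Fintype.ofFinite _
  have e' := MonoidAlgebra.coeffLinearEquiv K (S := K) (M := PresentedGroup (D3Rels m₁ m₂))
  have : Module.Finite K (MonoidAlgebra K (PresentedGroup (D3Rels m₁ m₂))) :=
    Module.Finite.equiv e'.symm
  have hd : finrank K (MonoidAlgebra K (PresentedGroup (D3Rels m₁ m₂))) ≤ 2 ^ (m₁ + m₂ + 2) := by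
    rw [e'.finrank_eq, finrank_finsupp_self, ← Nat.card_eq_fintype_card]
    exact hcard
  -- The dimensions 2^(m₁+m₂+1) and 4·2^(m₁-1+m₂) add up to 2^(m₁+m₂+2).
  obtain ⟨F, i₁, i₂, Q, i₃, i₄, hF, hQ, ⟨φ⟩⟩ := isSumOfFieldsAndQuaternions_of_surjective h2
    (IsUnit.of_pow_eq_one CentralPart.gen_one_pow (by positivity)) hf hg hz hz' (by
      rw [sum_finrank_quotient AbelianPart.gen_pow_eq_one,
        sum_finrank_quotient (CentralPart.gen_pow_eq_one hm), AbelianPart.levelCountLE_eq h2,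
        CentralPart.levelCountLE_eq h2, if_pos (by omega), min_eq_left (by omega),
        min_eq_left (by omega), min_eq_left (by omega), min_eq_left (by omega)]
      refine hd.trans_eq ?_
      obtain ⟨m, rfl⟩ := Nat.exists_eq_add_of_le' hm
      rw [Nat.add_sub_cancel]
      ring)
  exact ⟨F, i₁, i₂, Q, i₃, i₄, hF, hQ, ⟨(MonoidAlgebra.domCongr K K e).trans φ⟩⟩

end D3Group

/-! ### Cyclotomic degrees over ℚ and over finite fields -/

theorem hasCyclotomicDegrees_rat : HasCyclotomicDegrees ℚ fun k => (2 ^ k).totient := by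
  intro E _ _ ζ k hζ h
  have : IsCyclotomicExtension {2 ^ k} ℚ E := by
    rw [IsCyclotomicExtension.iff_singleton]
    refine ⟨⟨ζ, hζ⟩, fun x => ?_⟩
    have hx : x ∈ Algebra.adjoin ℚ {ζ} := h ▸ trivial
    refine Algebra.adjoin_mono ?_ hx
    simpa using hζ.pow_eq_one
  have : NeZero (2 ^ k) := ⟨by positivity⟩
  exact IsCyclotomicExtension.finrank E (Polynomial.cyclotomic.irreducible_rat (by positivity))

/-- The degree is the order of Frobenius, whose powers are determined by their effect ζ ↦ ζ^(q^n) on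
the generator. -/
theorem hasCyclotomicDegrees_finite (K : Type u) [Field K] [Finite K] :
    HasCyclotomicDegrees K fun k => orderOf (Nat.card K : ZMod (2 ^ k)) := by
  intro E _ _ ζ k hζ h
  have := Fintype.ofFinite K
  have hint : IsIntegral K ζ := IsIntegral.of_pow (n := 2 ^ k) (by positivity)
    (by rw [hζ.pow_eq_one]; exact isIntegral_one)
  have hfin : Module.Finite K E := by
    refine ⟨?_⟩
    rw [← Algebra.top_toSubmodule, ← h]
    exact hint.fg_adjoin_singleton
  have : Finite E := Module.finite_of_finite K
  rw [← FiniteField.orderOf_frobeniusAlgEquivOfAlgebraic, orderOf_eq_orderOf_iff]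
  intro n
  have h1 : FiniteField.frobeniusAlgEquivOfAlgebraic K E ^ n = 1 ↔
      ζ ^ (Nat.card K) ^ n = ζ := by
    have hF : (FiniteField.frobeniusAlgEquivOfAlgebraic K E ^ n) ζ = ζ ^ (Nat.card K) ^ n := by
      rw [AlgEquiv.coe_pow, FiniteField.coe_frobeniusAlgEquivOfAlgebraic, pow_iterate,
        Nat.card_eq_fintype_card]
    rw [← hF]
    constructor
    · intro h
      rw [h, AlgEquiv.one_apply]
    · intro h'
      refine AlgEquiv.coe_toAlgHom_injective (AlgHom.ext_of_adjoin_eq_top h ?_)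
      rintro _ rfl
      exact h'
  rw [h1, ← Nat.cast_pow, ← Nat.cast_one, ZMod.natCast_eq_natCast_iff]
  nth_rewrite 2 [← pow_one ζ]
  rw [(isOfFinOrder_iff_pow_eq_one.2 ⟨2 ^ k, by positivity, hζ.pow_eq_one⟩).pow_eq_pow_iff_modEq,
    ← hζ.eq_orderOf]

/-- An odd square is 1 mod 8, and each further squaring gains a factor 2. -/
theorem two_pow_dvd_pow_sub_one_of_odd {q : ℕ} (hq : Odd q) (j : ℕ) :
    (2 : ℤ) ^ (j + 3) ∣ (q : ℤ) ^ 2 ^ (j + 1) - 1 := by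
  induction j with
  | zero => 
    obtain ⟨r, rfl⟩ := hq
    obtain ⟨s, hs⟩ := Int.even_mul_succ_self r
    refine ⟨s, ?_⟩
    push_cast
    linear_combination 4 * hs
  | succ j ih =>
    obtain ⟨c, hc⟩ := ih
    refine ⟨c * (2 ^ (j + 2) * c + 1), ?_⟩
    rw [pow_succ 2 (j + 1), pow_mul, show (q : ℤ) ^ 2 ^ (j + 1) = 2 ^ (j + 3) * c + 1 by
      linear_combination hc]
    ring

/-- Here q² ≡ 9 mod 16, and squaring 1 + 2^a·u with u odd and a ≥ 2 raises the valuation of the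
difference from 1 by exactly one. -/
theorem two_pow_exact_of_three_mod_eight {q : ℕ} (hq : q ≡ 3 [MOD 8]) (j : ℕ) :
    ∃ c : ℤ, (q : ℤ) ^ 2 ^ (j + 1) = 1 + 2 ^ (j + 3) * (2 * c + 1) := by
  induction j with
  | zero =>
    have h := Nat.mod_add_div q 8
    have hq' : q % 8 = 3 := hq
    refine ⟨4 * (q / 8 : ℕ) ^ 2 + 3 * (q / 8 : ℕ), ?_⟩
    rw [hq'] at h
    generalize q / 8 = r at *
    subst h
    push_cast
    ring
  | succ j ih =>
    obtain ⟨c, hc⟩ := ih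
    refine ⟨c + 2 ^ (j + 1) * (2 * c + 1) ^ 2, ?_⟩
    rw [pow_succ 2 (j + 1), pow_mul, hc]
    ring

/-- The degree over `𝔽_q`, for `q ≡ 3 mod 8`, of a primitive `2 ^ k`-th root of unity. -/
def threeModEightDegree (k : ℕ) : ℕ :=
  if k ≤ 2 then (2 ^ k).totient else 2 ^ (k - 2)

theorem natCast_pow_eq_one_iff (q n k : ℕ) :
    (q : ZMod (2 ^ k)) ^ n = 1 ↔ (2 : ℤ) ^ k ∣ (q : ℤ) ^ n - 1 := by
  have := ZMod.intCast_zmod_eq_zero_iff_dvd ((q : ℤ) ^ n - 1) (2 ^ k)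
  push_cast at this
  rw [← this, sub_eq_zero]

/-- This holds for every odd `q`, and is the source of the lower bounds over all finite fields of
odd order. -/
theorem natCast_pow_threeModEightDegree {q : ℕ} (hq : Odd q) (k : ℕ) :
    (q : ZMod (2 ^ k)) ^ threeModEightDegree k = 1 := by
  unfold threeModEightDegree
  split_ifs with h
  · have hc : q.Coprime (2 ^ k) := (Nat.coprime_two_right.2 hq).pow_right k
    rw [← Nat.cast_pow, ← Nat.cast_one, ZMod.natCast_eq_natCast_iff]
    exact Nat.ModEq.pow_totient hc
  · obtain ⟨j, rfl⟩ := Nat.exists_eq_add_of_lt (not_le.1 h)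
    rw [natCast_pow_eq_one_iff, show 2 + j + 1 = j + 3 by ring, show j + 3 - 2 = j + 1 by omega]
    exact two_pow_dvd_pow_sub_one_of_odd hq j

theorem threeModEightDegree_pos (k : ℕ) : 0 < threeModEightDegree k := by
  unfold threeModEightDegree
  split_ifs
  · exact Nat.totient_pos.2 (by positivity)
  · positivity

theorem orderOf_pos_of_odd {q : ℕ} (hq : Odd q) (k : ℕ) : 0 < orderOf (q : ZMod (2 ^ k)) :=
  orderOf_pos_iff.2 (isOfFinOrder_iff_pow_eq_one.2
    ⟨_, threeModEightDegree_pos k, natCast_pow_threeModEightDegree hq k⟩)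

theorem orderOf_le_threeModEightDegree {q : ℕ} (hq : Odd q) (k : ℕ) :
    orderOf (q : ZMod (2 ^ k)) ≤ threeModEightDegree k :=
  orderOf_le_of_pow_eq_one (threeModEightDegree_pos k) (natCast_pow_threeModEightDegree hq k)

/-- For k ≥ 3 it remains to see that q^(2^(k-3)) ≠ 1 modulo 2^k: directly if k = 3, and otherwise
because its difference from 1 has valuation exactly k - 1. -/
theorem orderOf_eq_threeModEightDegree {q : ℕ} (hq : q ≡ 3 [MOD 8]) (k : ℕ) :
    orderOf (q : ZMod (2 ^ k)) = threeModEightDegree k := by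
  have hq' : q % 8 = 3 := hq
  have hodd : Odd q := Nat.odd_iff.2 (by omega)
  have hle := orderOf_le_threeModEightDegree hodd k
  have hpos := orderOf_pos_of_odd hodd k
  rcases Nat.lt_or_ge k 2 with h | h
  · have h1 : threeModEightDegree k = 1 := by
      unfold threeModEightDegree
      rw [if_pos h.le]
      interval_cases k <;> decide
    omega
  obtain rfl | h := h.eq_or_lt
  · have h1 : threeModEightDegree 2 = 2 := by
      unfold threeModEightDegree; decide
    have h2 : orderOf (q : ZMod (2 ^ 2)) ≠ 1 := by
      rw [Ne, orderOf_eq_one_iff, ← pow_one (q : ZMod (2 ^ 2)), natCast_pow_eq_one_iff,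
        pow_one]
      omega
    omega
  · obtain ⟨j, rfl⟩ := Nat.exists_eq_add_of_lt h
    have hd : threeModEightDegree (2 + j + 1) = 2 ^ (j + 1) := by
      unfold threeModEightDegree
      rw [if_neg (by omega)]
      congr 1
      omega
    have h1 := natCast_pow_threeModEightDegree hodd (2 + j + 1)
    rw [hd] at h1 ⊢
    refine orderOf_eq_prime_pow ?_ h1
    rw [natCast_pow_eq_one_iff]
    rcases j with _ | j
    · rw [pow_zero, pow_one]
      omega
    · obtain ⟨c, hc⟩ := two_pow_exact_of_three_mod_eight hq j
      rw [hc, show 2 + (j + 1) + 1 = (j + 3) + 1 by ring, pow_succ, add_sub_cancel_left,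
        mul_dvd_mul_iff_left (by positivity)]
      omega

/-- The number of components over `𝔽_q`, for `q ≡ 3 mod 8`, in terms of that over `ℚ`. -/
def doubledCount (c : ℕ → ℕ) (k : ℕ) : ℕ := if k ≤ 2 then c k else 2 * c k

theorem doubledCount_mul (c : ℕ → ℕ) (k : ℕ) :
    doubledCount c k * threeModEightDegree k = c k * (2 ^ k).totient := by
  unfold doubledCount threeModEightDegree
  split_ifs with h
  · rfl
  · obtain ⟨j, rfl⟩ := Nat.exists_eq_add_of_lt (not_le.1 h)
    rw [Nat.totient_prime_pow Nat.prime_two (by omega), show 2 + j + 1 - 1 = (2 + j + 1 - 2) + 1 by omega,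
      pow_succ]
    ring

/-- Only levels 0, 1, 2 escape the doubling, so they form the correction term. -/
theorem sum_doubledCount (c : ℕ → ℕ) {n : ℕ} (hn : 2 ≤ n) :
    ∑ k ∈ Finset.range (n + 1), doubledCount c k + (c 0 + c 1 + c 2) =
      2 * ∑ k ∈ Finset.range (n + 1), c k := by
  induction n, hn using Nat.le_induction with
  | base =>
    simp [Finset.sum_range_succ, doubledCount]
    ring
  | succ n hn ih =>
    rw [Finset.sum_range_succ, Finset.sum_range_succ c, mul_add, ← ih, doubledCount,
      if_neg (by omega)]
    ring

/-! ### Numbers of components from level counts -/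

namespace RootAlgebra

variable {ι : Type} {K : Type u} [Field K] {e : ι → ℕ} {a : ι → K}

theorem card_maximalSpectrum_of_totient [PerfectField K] [Module.Finite K (RootAlgebra K e a)]
    [Fintype (MaximalSpectrum (RootAlgebra K e a))] {n : ℕ} (hn : ∀ i, gen e a i ^ 2 ^ n = 1)
    (hd : HasCyclotomicDegrees K fun k => (2 ^ k).totient) {c : ℕ → ℕ}
    (hc : ∀ k, levelCount K e a k = c k * (2 ^ k).totient) :
    Fintype.card (MaximalSpectrum (RootAlgebra K e a)) = ∑ k ∈ Finset.range (n + 1), c k := by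
  rw [card_maximalSpectrum hn]
  refine Finset.sum_congr rfl fun k _ => ?_
  have h := (card_level_mul hn hd k).trans (hc k)
  exact Nat.eq_of_mul_eq_mul_right (Nat.totient_pos.2 (by positivity)) h

/-- The number of solutions of each level is fixed, so smaller residue degrees mean more maximal
ideals. -/
theorem card_maximalSpectrum_of_finite [Finite K] (hK : Odd (Nat.card K))
    [Module.Finite K (RootAlgebra K e a)]
    [Fintype (MaximalSpectrum (RootAlgebra K e a))] {n : ℕ} (hn : ∀ i, gen e a i ^ 2 ^ n = 1)
    {c : ℕ → ℕ} (hc : ∀ k, levelCount K e a k = c k * (2 ^ k).totient) :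
    ∑ k ∈ Finset.range (n + 1), doubledCount c k ≤
        Fintype.card (MaximalSpectrum (RootAlgebra K e a)) ∧
      (Nat.card K ≡ 3 [MOD 8] → Fintype.card (MaximalSpectrum (RootAlgebra K e a)) =
        ∑ k ∈ Finset.range (n + 1), doubledCount c k) := by
  rw [card_maximalSpectrum hn]
  have h (k : ℕ) := (card_level_mul hn (hasCyclotomicDegrees_finite K) k).trans
    ((hc k).trans (doubledCount_mul c k).symm)
  refine ⟨Finset.sum_le_sum fun k _ => ?_, fun h3 => Finset.sum_congr rfl fun k _ => ?_⟩
  · refine Nat.le_of_mul_le_mul_right ?_ (threeModEightDegree_pos k)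
    rw [← h k]
    exact Nat.mul_le_mul_left _ (orderOf_le_threeModEightDegree hK k)
  · have hk := h k
    simp only [orderOf_eq_threeModEightDegree h3] at hk
    exact Nat.eq_of_mul_eq_mul_right (threeModEightDegree_pos k) hk

end RootAlgebra

/-! ### Explicit level counts and their sums -/

/-- The number of rational irreducible characters of order `2 ^ k` of a product of cyclic groups of
orders `2`, `2 ^ p` and `2 ^ q`, where `p ≤ q`. -/
def abelianCount (p q k : ℕ) : ℕ :=
  if k = 0 then 1 else if k = 1 then 7 else if k ≤ p then 6 * 2 ^ (k - 1)
  else if k ≤ q then 2 ^ (p + 1) else 0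

theorem sum_abelianCount {p q : ℕ} (hp : 2 ≤ p) (hpq : p ≤ q) {n : ℕ} (hn : q ≤ n) :
    ∑ k ∈ Finset.range (n + 1), abelianCount p q k + 4 = 2 ^ (p + 1) * (3 + (q - p)) := by
  -- With 4 added, the partial sums start at 1 + 7 + 4 = 12 and double at each level up to `p`; this
  -- is the -4 of N₀.
  have h1 : ∀ k, 1 ≤ k → k ≤ p → ∑ j ∈ Finset.range (k + 1), abelianCount p q j + 4 = 6 * 2 ^ k := by
    intro k hk
    induction k, hk using Nat.le_induction with
    | base => intro _; simp [Finset.sum_range_succ, abelianCount]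
    | succ k hk ih =>
      intro hkp
      rw [Finset.sum_range_succ, add_right_comm, ih (by omega), abelianCount, if_neg (by omega),
        if_neg (by omega), if_pos hkp, Nat.add_sub_cancel]
      ring
  have h2 : ∀ k, p + k ≤ q → ∑ j ∈ Finset.range (p + k + 1), abelianCount p q j + 4 =
      2 ^ (p + 1) * (3 + k) := by
    intro k
    induction k with
    | zero => intro _; rw [add_zero, h1 p (by omega) le_rfl]; ring
    | succ k ih =>
      intro hk
      rw [Finset.sum_range_succ, add_right_comm, ← add_assoc p k 1, ih (by omega), abelianCount,
        if_neg (by omega), if_neg (by omega), if_neg (by omega), if_pos (by omega)]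
      ring
  induction n, hn using Nat.le_induction with
  | base =>
    have := h2 (q - p) (by omega)
    rwa [Nat.add_sub_cancel' hpq] at this
  | succ n hn ih =>
    rw [Finset.sum_range_succ, add_right_comm, ih, abelianCount, if_neg (by omega),
        if_neg (by omega), if_neg (by omega), if_neg (by omega), add_zero]

/-- The number of classes of level `k` in the central part. -/
def centralCount (m₁ m₂ k : ℕ) : ℕ :=
  if k < m₁ then 0 else if k = m₁ then 2 ^ min m₁ m₂ else if k ≤ m₂ then 2 ^ (m₁ - 1) else 0

/-- After level m₁, each of the m₂ - m₁ further levels contributes 2^(m₁-1); truncated subtraction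
covers m₂ ≤ m₁. -/
theorem sum_centralCount {m₁ m₂ n : ℕ} (h1 : m₁ ≤ n) (h2 : m₂ ≤ n) :
    ∑ k ∈ Finset.range (n + 1), centralCount m₁ m₂ k =
      2 ^ min m₁ m₂ + (m₂ - m₁) * 2 ^ (m₁ - 1) := by
  have key : ∀ k, ∑ j ∈ Finset.range (m₁ + k + 1), centralCount m₁ m₂ j =
      2 ^ min m₁ m₂ + (min m₂ (m₁ + k) - m₁) * 2 ^ (m₁ - 1) := by
    intro k
    induction k with
    | zero =>
      have h0 : ∑ j ∈ Finset.range m₁, centralCount m₁ m₂ j = 0 :=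
        Finset.sum_eq_zero fun j hj => if_pos (Finset.mem_range.1 hj)
      rw [add_zero, Finset.sum_range_succ, h0]
      simp [centralCount]
    | succ k ih =>
      rw [← add_assoc m₁ k 1, Finset.sum_range_succ, ih, centralCount, if_neg (by omega),
        if_neg (by omega)]
      split_ifs with h
      · rw [show min m₂ (m₁ + k + 1) - m₁ = (min m₂ (m₁ + k) - m₁) + 1 by omega]
        ring
      · rw [show min m₂ (m₁ + k + 1) - m₁ = min m₂ (m₁ + k) - m₁ by omega, add_zero]
  obtain ⟨k, rfl⟩ := Nat.exists_eq_add_of_le h1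
  rw [key, min_eq_left h2]

section Counts

variable {K : Type u} [Field K] {m₁ m₂ : ℕ}

open RootAlgebra

/-- The count at level k + 1 is the increment of 2^(1 + min p k + min q k), symmetric in p = m₁-1
and q = m₂+1, divided by φ(2^(k+1)) = 2^k. -/
theorem AbelianPart.levelCount_eq (h2 : (2 : K) ≠ 0) (h₁ : 3 ≤ m₁) (h₂ : 3 ≤ m₂) (k : ℕ) :
    levelCount K ![2, 2 ^ (m₁ - 1), 2 ^ (m₂ + 1)] (fun _ => 1) k =
      abelianCount (min (m₁ - 1) (m₂ + 1)) (max (m₁ - 1) (m₂ + 1)) k * (2 ^ k).totient := by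
  rcases k with _ | k
  · rw [levelCount_zero AbelianPart.gen_pow_eq_one, AbelianPart.levelCountLE_eq h2]
    simp [abelianCount]
  · have h := levelCount_succ (K := K) (e := ![2, 2 ^ (m₁ - 1), 2 ^ (m₂ + 1)]) (c := fun _ => 1)
      (fun i => by fin_cases i <;> simp) AbelianPart.gen_pow_eq_one k
    rw [AbelianPart.levelCountLE_eq h2, AbelianPart.levelCountLE_eq h2] at h
    refine Nat.add_right_cancel (h.trans ?_)
    rw [Nat.totient_prime_pow_succ Nat.prime_two, abelianCount, if_neg (by omega)]
    have hp : 2 ≤ m₁ - 1 := by omega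
    have hq : 2 ≤ m₂ + 1 := by omega
    clear h
    generalize m₁ - 1 = p at *
    generalize m₂ + 1 = q at *
    rcases Nat.eq_zero_or_pos k with rfl | hk
    · rw [if_pos rfl, min_eq_right (by omega : 0 + 1 ≤ p), min_eq_right (by omega : 0 + 1 ≤ q)]
      simp
    rw [if_neg (by omega), min_eq_left (by omega : 1 ≤ k + 1), min_eq_left (by omega : 1 ≤ k),
      Nat.add_sub_cancel]
    split_ifs with h1 h3
    · rw [min_eq_right (by omega : k + 1 ≤ p), min_eq_right (by omega : k + 1 ≤ q),
        min_eq_right (by omega : k ≤ p), min_eq_right (by omega : k ≤ q)]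
      ring
    · rw [show 1 + min p (k + 1) + min q (k + 1) = min p q + 1 + k + 1 by omega,
        show 1 + min p k + min q k = min p q + 1 + k by omega]
      ring
    · rw [show 1 + min p (k + 1) + min q (k + 1) = 1 + min p k + min q k by omega, zero_mul, zero_add]

/-- The image of t₁ has order exactly 2^m₁, so no level below m₁ occurs and all solutions for t₁
enter at level m₁. -/
theorem CentralPart.levelCount_eq (h2 : (2 : K) ≠ 0) (h₁ : 3 ≤ m₁) (k : ℕ) :
    levelCount K ![2 ^ (m₁ - 1), 2 ^ m₂] ![-1, 1] k =
      centralCount m₁ m₂ k * (2 ^ k).totient := by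
  rcases k with _ | k
  · rw [levelCount_zero (CentralPart.gen_pow_eq_one (by omega)), CentralPart.levelCountLE_eq h2,
      if_neg (by omega), centralCount, if_pos (by omega), zero_mul]
  · have h := levelCount_succ (K := K) (e := ![2 ^ (m₁ - 1), 2 ^ m₂]) (c := ![-1, 1])
      (fun i => by fin_cases i <;> simp) (CentralPart.gen_pow_eq_one (by omega)) k
    rw [CentralPart.levelCountLE_eq h2, CentralPart.levelCountLE_eq h2] at h
    refine Nat.add_right_cancel (h.trans ?_)
    rw [Nat.totient_prime_pow_succ Nat.prime_two, centralCount]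
    obtain ⟨m, rfl⟩ := Nat.exists_eq_add_of_le' (show 1 ≤ m₁ by omega)
    simp only [Nat.add_sub_cancel]
    rcases lt_trichotomy k m with hk | rfl | hk
    · rw [if_neg (by omega), if_pos (by omega), if_neg (by omega), zero_mul]
    · rw [if_pos (by omega), if_neg (by omega), if_pos rfl, if_neg (by omega), min_comm, pow_add]
      ring
    · rw [if_pos (by omega), if_neg (by omega), if_neg (by omega), if_pos hk]
      split_ifs with h
      · rw [min_eq_right h, min_eq_right (by omega)]
        ring
      · rw [min_eq_left (by omega), min_eq_left (by omega), zero_mul, zero_add]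

end Counts

theorem sum_abelianCount_eq_numN₀ {m₁ m₂ : ℕ} (h₁ : 3 ≤ m₁) (h₂ : 3 ≤ m₂) :
    ((∑ k ∈ Finset.range (m₁ + m₂ + 1 + 1),
      abelianCount (min (m₁ - 1) (m₂ + 1)) (max (m₁ - 1) (m₂ + 1)) k : ℕ) : ℤ) = numN₀ m₁ m₂ := by
  have h := sum_abelianCount (p := min (m₁ - 1) (m₂ + 1)) (q := max (m₁ - 1) (m₂ + 1))
    (n := m₁ + m₂ + 1) (by omega) (by omega) (by omega)
  rw [← add_right_cancel_iff (a := (4 : ℤ))]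
  refine (congrArg (Nat.cast : ℕ → ℤ) h).trans ?_
  obtain ⟨m, rfl⟩ := Nat.exists_eq_add_of_le' (show 1 ≤ m₁ by omega)
  rw [Nat.add_sub_cancel]
  unfold numN₀
  split_ifs with h h'
  · rw [min_eq_right (by omega), max_eq_left (by omega)]
    push_cast [show m₂ + 1 ≤ m by omega]
    ring
  -- This is the boundary case p = m₂, q = m₂ + 1, giving 2^(m₂+1)·4.
  · obtain rfl : m = m₂ := by omega
    rw [min_eq_left (by omega), max_eq_right (by omega), Nat.add_sub_cancel_left]
    push_cast
    ring
  · rw [min_eq_left (by omega), max_eq_right (by omega)]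
    push_cast [show m ≤ m₂ + 1 by omega]
    ring

theorem sum_centralCount_eq_sub {m₁ m₂ : ℕ} (h₁ : 3 ≤ m₁) :
    ((∑ k ∈ Finset.range (m₁ + m₂ + 1 + 1), centralCount m₁ m₂ k : ℕ) : ℤ) =
      numN m₁ m₂ - numN₀ m₁ m₂ := by
  rw [sum_centralCount (by omega) (by omega)]
  unfold numN numN₀
  split_ifs with h h'
  · rw [min_eq_right (by omega), Nat.sub_eq_zero_of_le (by omega)]
    push_cast
    ring
  · rw [min_eq_right (by omega), Nat.sub_eq_zero_of_le (by omega)]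
    push_cast
    ring
  · rw [min_eq_left (by omega)]
    obtain ⟨m, rfl⟩ := Nat.exists_eq_add_of_le' (show 1 ≤ m₁ by omega)
    rw [Nat.add_sub_cancel]
    push_cast [show m + 1 ≤ m₂ by omega]
    ring

/-! ### Conclusion over ℚ and over finite fields -/

theorem mainTheorem3 (m₁ m₂ : ℕ) (hm₁ : 3 ≤ m₁) (hm₂ : 3 ≤ m₂)
    (G : Type v) [Group G] (hG : IsTypeD3 m₁ m₂ G) :
    (∃ r k : ℕ, (r : ℤ) = numN₀ m₁ m₂ ∧ (k : ℤ) = numN m₁ m₂ - numN₀ m₁ m₂ ∧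
      IsSumOfFieldsAndQuaternions ℚ (MonoidAlgebra ℚ G) r k) ∧
    ∀ (K : Type u) [Field K] [Finite K], Odd (Nat.card K) →
      ∃ r k : ℕ,
        2 * numN₀ m₁ m₂ - 20 ≤ (r : ℤ) ∧
        (2 * numN m₁ m₂ - 20) - (2 * numN₀ m₁ m₂ - 20) ≤ (k : ℤ) ∧
        (Nat.card K ≡ 3 [MOD 8] →
          (r : ℤ) = 2 * numN₀ m₁ m₂ - 20 ∧
          (k : ℤ) = (2 * numN m₁ m₂ - 20) - (2 * numN₀ m₁ m₂ - 20)) ∧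
        IsSumOfFieldsAndQuaternions K (MonoidAlgebra K G) r k := by
  have hA := sum_abelianCount_eq_numN₀ hm₁ hm₂
  have hC := sum_centralCount_eq_sub (m₂ := m₂) hm₁
  refine ⟨?_, fun K _ _ hK => ?_⟩
  · have iA : IsArtinianRing (AbelianPart ℚ m₁ m₂) := IsArtinianRing.of_finite ℚ _
    have iC : IsArtinianRing (CentralPart ℚ m₁ m₂) := IsArtinianRing.of_finite ℚ _
    have := Fintype.ofFinite (MaximalSpectrum (AbelianPart ℚ m₁ m₂))
    have := Fintype.ofFinite (MaximalSpectrum (CentralPart ℚ m₁ m₂))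
    refine ⟨_, _, ?_, ?_, D3Group.isSumOfFieldsAndQuaternions two_ne_zero hG⟩
    · rw [RootAlgebra.card_maximalSpectrum_of_totient AbelianPart.gen_pow_eq_one
        hasCyclotomicDegrees_rat (AbelianPart.levelCount_eq two_ne_zero hm₁ hm₂), hA]
    · rw [RootAlgebra.card_maximalSpectrum_of_totient (CentralPart.gen_pow_eq_one (by omega))
        hasCyclotomicDegrees_rat (CentralPart.levelCount_eq two_ne_zero hm₁), hC]
  · have h2 : (2 : K) ≠ 0 := by
      intro h
      obtain ⟨r, hr⟩ := hK
      have := Fintype.ofFinite K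
      have hc : (Nat.card K : K) = 0 := by
        rw [Nat.card_eq_fintype_card, Nat.cast_card_eq_zero]
      rw [hr] at hc
      push_cast at hc
      rw [h, zero_mul, zero_add] at hc
      exact one_ne_zero hc
    have iA : IsArtinianRing (AbelianPart K m₁ m₂) := IsArtinianRing.of_finite K _
    have iC : IsArtinianRing (CentralPart K m₁ m₂) := IsArtinianRing.of_finite K _
    have := Fintype.ofFinite (MaximalSpectrum (AbelianPart K m₁ m₂))
    have := Fintype.ofFinite (MaximalSpectrum (CentralPart K m₁ m₂))
    obtain ⟨leA, eqA⟩ := RootAlgebra.card_maximalSpectrum_of_finite hK AbelianPart.gen_pow_eq_one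
      (AbelianPart.levelCount_eq h2 hm₁ hm₂)
    obtain ⟨leC, eqC⟩ := RootAlgebra.card_maximalSpectrum_of_finite hK
      (CentralPart.gen_pow_eq_one (m₂ := m₂) (by omega)) (CentralPart.levelCount_eq h2 hm₁)
    change _ ≤ Fintype.card (MaximalSpectrum (AbelianPart K m₁ m₂)) at leA
    change _ → Fintype.card (MaximalSpectrum (AbelianPart K m₁ m₂)) = _ at eqA
    change _ ≤ Fintype.card (MaximalSpectrum (CentralPart K m₁ m₂)) at leC
    change _ → Fintype.card (MaximalSpectrum (CentralPart K m₁ m₂)) = _ at eqC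
    have dA := sum_doubledCount (abelianCount (min (m₁ - 1) (m₂ + 1)) (max (m₁ - 1) (m₂ + 1)))
      (n := m₁ + m₂ + 1) (by omega)
    have dC := sum_doubledCount (centralCount m₁ m₂) (n := m₁ + m₂ + 1) (by omega)
    have zA : abelianCount (min (m₁ - 1) (m₂ + 1)) (max (m₁ - 1) (m₂ + 1)) 0 +
        abelianCount (min (m₁ - 1) (m₂ + 1)) (max (m₁ - 1) (m₂ + 1)) 1 +
        abelianCount (min (m₁ - 1) (m₂ + 1)) (max (m₁ - 1) (m₂ + 1)) 2 = 20 := by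
      have : 2 ≤ min (m₁ - 1) (m₂ + 1) := by omega
      simp [abelianCount, -le_inf_iff, this]
    -- Since m₁ ≥ 3, every quaternion component has level at least 3, so the doubling is complete
    -- there.
    have zC : centralCount m₁ m₂ 0 + centralCount m₁ m₂ 1 + centralCount m₁ m₂ 2 = 0 := by
      rw [centralCount, centralCount, centralCount, if_pos (by omega), if_pos (by omega),
        if_pos (by omega)]
    refine ⟨_, _, ?_, ?_, fun h3 => ⟨?_, ?_⟩, D3Group.isSumOfFieldsAndQuaternions h2 hG⟩
    · omega
    · omega
    · have := eqA h3
      omega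
    · have := eqC h3
      omega
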